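/- Let $\mathbb K=\mathbb R$ or $\mathbb C$, let $X$ be a formal or analytic vector field on $(\mathbb K^m,0)$ with $X(0)=0$, and let $\mathcal G$ be a formal or analytic tensor field on $(\mathbb K^m,0)$, of any contravariant order $k$ and any covariant order $h$. Analytic objects are identified with their Taylor series at $0$ when formal objects act on them, and objects over $\mathbb R$ are complexified. Associated torus action. Let $\Phi$ be a formal change of coordinates of $(\mathbb C^m,0)$ which puts $X$ into Poincaré–Dulac normal form, i.e. $Y=\Phi_*X$ satisfies $[Y,Y^s]=0$, where $Y^s=\sum_{j}\gamma_j\,y_j\,\partial/\partial y_j$ is the (diagonal) semisimple part of the linear part of $Y$. Let $d$ (the toric degree of $X$) be the smallest integer such that $Y^s=\sum_{k=1}^d\alpha_kZ_k$ with $\alpha_k\in\mathbb C$ and $Z_k=\sum_{j}\rho^k_j\,y_j\,\partial/\partial y_j$, $\rho^k_j\in\mathbb Z$, and choose such a decomposition for which the linear action $t\cdot y=\big(\prod_k t_k^{\rho^k_1}y_1,\dots,\prod_k t_k^{\rho^k_m}y_m\big)$ of $\mathbb T^d=(S^1)^d$, generated by $\sqrt{-1}Z_1,\dots,\sqrt{-1}Z_d$,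 is effective. The formal $\mathbb T^d$-action $\varphi_t=\Phi^{-1}\circ(t\,\cdot)\circ\Phi$ on $(\mathbb C^m,0)$ is called an associated torus action of $X$ at $0$. Theorem. $X$ has an associated torus action at $0$, and if $X$ preserves $\mathcal G$, i.e. $\mathcal L_X\mathcal G=0$ (formally, resp. in a neighbourhood of $0$), then every associated torus action of $X$ at $0$ preserves $\mathcal G$: $\varphi_t^*\mathcal G=\mathcal G$ for all $t\in\mathbb T^d$. -/

import Mathlib

open scoped Topology

noncomputable section

/-! ### Vector fields and tensor fields in coordinates

`R` is a ring of functions of `m` variables and `D i : R → R` is the partial derivative with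
respect to the `i`-th variable.  It is used for formal power series and for actual functions. -/

/-- A vector field `∑ i, X i ∂/∂x_i`, given by its components. -/
abbrev VField (m : ℕ) (R : Type*) := Fin m → R

/-- A tensor field of contravariant order `k` and covariant order `h`, i.e. a section of
`⊗^k T ⊗ ⊗^h T*`, given by its components: `G a b` is the coefficient of
`∂/∂x_{a 0} ⊗ ⋯ ⊗ ∂/∂x_{a (k-1)} ⊗ dx_{b 0} ⊗ ⋯ ⊗ dx_{b (h-1)}`. -/
abbrev TField (m k h : ℕ) (R : Type*) := (Fin k → Fin m) → (Fin h → Fin m) → R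

/-- The Lie bracket `[X, Y]` of vector fields. -/
def lieBracketCoord {m : ℕ} {R : Type*} [CommRing R] (D : Fin m → R → R) (X Y : VField m R) :
    VField m R :=
  fun i => ∑ l, (X l * D l (Y i) - Y l * D l (X i))

/-- The Lie derivative `L_X G` of a tensor field along a vector field. -/
def lieDerivCoord {m k h : ℕ} {R : Type*} [CommRing R] (D : Fin m → R → R) (X : VField m R)
    (G : TField m k h R) : TField m k h R :=
  fun a b =>
    ∑ l, X l * D l (G a b)
      - ∑ i, ∑ l, G (Function.update a i l) b * D l (X (a i))
      + ∑ j, ∑ l, G a (Function.update b j l) * D (b j) (X l)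

/-! ### Formal objects -/

/-- Formal power series in `m` variables. -/
abbrev FSeries (m : ℕ) (K : Type*) := MvPowerSeries (Fin m) K

/-- Formal partial derivatives. -/
def formalPartial {m : ℕ} {K : Type*} [CommRing K] (i : Fin m) (f : FSeries m K) : FSeries m K :=
  MvPowerSeries.pderiv K i f

/-- The composition `φ ∘ ψ` of formal maps fixing the origin. -/
def formalComp {m : ℕ} {K : Type*} [CommRing K] (φ ψ : Fin m → FSeries m K) : Fin m → FSeries m K :=
  fun i => MvPowerSeries.subst ψ (φ i)

/-- The identity map, i.e. the tuple of the coordinate functions. -/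
def formalId (m : ℕ) (K : Type*) [CommRing K] : Fin m → FSeries m K :=
  fun i => MvPowerSeries.X i

/-- A formal map sends the origin to the origin. -/
def FixesOrigin {m : ℕ} {K : Type*} [CommRing K] (φ : Fin m → FSeries m K) : Prop :=
  ∀ i, MvPowerSeries.constantCoeff (φ i) = 0

/-- Formal diffeomorphisms fixing the origin (formal changes of coordinates). -/
def IsFormalDiffeo {m : ℕ} {K : Type*} [CommRing K] (φ : Fin m → FSeries m K) : Prop :=
  FixesOrigin φ ∧ ∃ ψ : Fin m → FSeries m K, FixesOrigin ψ ∧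
    formalComp φ ψ = formalId m K ∧ formalComp ψ φ = formalId m K

/-- The Jacobian matrix `(∂φ_i/∂x_j)` of a formal map. -/
def formalJacobian {m : ℕ} {K : Type*} [CommRing K] (φ : Fin m → FSeries m K) :
    Matrix (Fin m) (Fin m) (FSeries m K) :=
  Matrix.of fun i j => formalPartial j (φ i)

/-- The pull-back `φ^* G` of a tensor field by a formal diffeomorphism.  The Jacobian matrix of a
formal diffeomorphism is invertible. -/
def formalPullback {m k h : ℕ} {K : Type*} [CommRing K] (φ : Fin m → FSeries m K)
    (G : TField m k h (FSeries m K)) : TField m k h (FSeries m K) :=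
  fun a b => ∑ a' : Fin k → Fin m, ∑ b' : Fin h → Fin m,
    (∏ i, (formalJacobian φ)⁻¹ (a i) (a' i)) * (∏ j, formalJacobian φ (b' j) (b j)) *
      MvPowerSeries.subst φ (G a' b')

/-- `Φ_* X = Y`, i.e. `dΦ(X) = Y ∘ Φ`: the vector field `X` reads as `Y` in the new coordinates
`y = Φ(x)`. -/
def FormalPushforwardEq {m : ℕ} {K : Type*} [CommRing K] (Φ : Fin m → FSeries m K)
    (X Y : VField m (FSeries m K)) : Prop :=
  ∀ i, ∑ j, formalPartial j (Φ i) * X j = MvPowerSeries.subst Φ (Y i)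

/-- The diagonal linear vector field `∑ j, γ_j x_j ∂/∂x_j`. -/
def diagField {m : ℕ} {K : Type*} [CommRing K] (γ : Fin m → K) : VField m (FSeries m K) :=
  fun j => MvPowerSeries.C (γ j) * MvPowerSeries.X j

/-- The matrix of the linear part `X^(1)` of a formal vector field. -/
def linearPart {m : ℕ} {K : Type*} [CommRing K] (X : VField m (FSeries m K)) :
    Matrix (Fin m) (Fin m) K :=
  Matrix.of fun i j => MvPowerSeries.coeff (Finsupp.single j 1) (X i)

/-- The semisimple part of the linear part of `Y` is the diagonal field with eigenvalues `γ`: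
the Jordan decomposition of the linear part is `diag γ + nilpotent`, with commuting summands. -/
def HasDiagonalSemisimplePart {m : ℕ} (Y : VField m (FSeries m ℂ)) (γ : Fin m → ℂ) : Prop :=
  IsNilpotent (linearPart Y - Matrix.diagonal γ) ∧
    Commute (Matrix.diagonal γ) (linearPart Y - Matrix.diagonal γ)

/-- `Y` is in Poincaré–Dulac normal form `[Y, Y^s] = 0`, in coordinates in which the semisimple part
`Y^s` of its linear part is the diagonal field with eigenvalues `γ`. -/
def IsPoincareDulacNormalForm {m : ℕ} (Y : VField m (FSeries m ℂ)) (γ : Fin m → ℂ) : Prop :=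
  FixesOrigin Y ∧ HasDiagonalSemisimplePart Y γ ∧
    lieBracketCoord formalPartial Y (diagField γ) = 0

/-- `γ = ∑ k, α_k ρ^k`, i.e. `∑ γ_j x_j ∂/∂x_j = ∑ k, α_k Z_k` for the diagonal vector fields
`Z_k = ∑ j, ρ^k_j x_j ∂/∂x_j` with integer coefficients. -/
def IsIntegralDecomposition {m d : ℕ} (γ : Fin m → ℂ) (α : Fin d → ℂ) (ρ : Fin d → Fin m → ℤ) :
    Prop :=
  ∀ j, γ j = ∑ k, α k * (ρ k j : ℂ)

/-- The toric degree: the smallest `d` such that `∑ γ_j x_j ∂/∂x_j` is a linear combination of `d`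
diagonal linear vector fields with integer coefficients (such a `d` always exists: `d = m`). -/
def toricDegree {m : ℕ} (γ : Fin m → ℂ) : ℕ :=
  sInf {d : ℕ | ∃ (α : Fin d → ℂ) (ρ : Fin d → Fin m → ℤ), IsIntegralDecomposition γ α ρ}

/-- A formal action of the torus `T^d = (S^1)^d` on `(ℂ^m, 0)` fixing the origin. -/
structure FormalTorusAction (d m : ℕ) where
  /-- The formal transformation of `(ℂ^m, 0)` given by a point of the torus. -/
  act : (Fin d → Circle) → Fin m → FSeries m ℂ
  fixesOrigin : ∀ t, FixesOrigin (act t)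
  act_one : act 1 = formalId m ℂ
  act_mul : ∀ s t, act (s * t) = formalComp (act s) (act t)

/-- The weight by which `t ∈ T^d` multiplies the `j`-th coordinate in the linear torus action
generated by `√-1 Z_1, …, √-1 Z_d`, `Z_k = ∑ j, ρ^k_j x_j ∂/∂x_j`. -/
def torusWeight {m d : ℕ} (ρ : Fin d → Fin m → ℤ) (t : Fin d → Circle) (j : Fin m) : Circle :=
  ∏ k, t k ^ ρ k j

/-- `A` is an associated torus action at the origin of the formal vector field `X`: in some formal
coordinates `y = Φ(x)` which put `X` into a Poincaré–Dulac normal form `Y`, with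
`Y^s = ∑ γ_j y_j ∂/∂y_j = ∑ k, α_k Z_k` and `d` equal to the toric degree, `A` is the effective
linear action of `T^d` generated by `√-1 Z_1, …, √-1 Z_d`. -/
def IsAssociatedTorusAction {m d : ℕ} (X : VField m (FSeries m ℂ)) (A : FormalTorusAction d m) :
    Prop :=
  ∃ (Φ : Fin m → FSeries m ℂ) (Y : VField m (FSeries m ℂ)) (γ : Fin m → ℂ)
    (α : Fin d → ℂ) (ρ : Fin d → Fin m → ℤ),
    IsFormalDiffeo Φ ∧ FormalPushforwardEq Φ X Y ∧ IsPoincareDulacNormalForm Y γ ∧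
    IsIntegralDecomposition γ α ρ ∧ d = toricDegree γ ∧
    (∀ t, (∀ j, torusWeight ρ t j = 1) → t = 1) ∧
    ∀ t j, formalComp Φ (A.act t) j = MvPowerSeries.C (torusWeight ρ t j : ℂ) * Φ j

/-- The torus action `A` preserves the tensor field `G`. -/
def FormalTorusAction.Preserves {d m k h : ℕ} (A : FormalTorusAction d m)
    (G : TField m k h (FSeries m ℂ)) : Prop :=
  ∀ t, formalPullback (A.act t) G = G

/-! ### Real and complex coefficients -/

/-- The embedding of `K = ℝ` or `ℂ` into `ℂ` (the identity if `K = ℂ`). -/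
def toComplexHom (K : Type*) [RCLike K] : K →+* ℂ where
  toFun z := ⟨RCLike.re z, RCLike.im z⟩
  map_one' := by apply Complex.ext <;> simp
  map_mul' x y := by apply Complex.ext <;> simp
  map_zero' := by apply Complex.ext <;> simp
  map_add' x y := by apply Complex.ext <;> simp

/-- Complexification of a formal vector field. -/
def VField.complexify {m : ℕ} {K : Type*} [RCLike K] (X : VField m (FSeries m K)) :
    VField m (FSeries m ℂ) :=
  fun i => MvPowerSeries.map (toComplexHom K) (X i)

/-- Complexification of a formal tensor field. -/
def TField.complexify {m k h : ℕ} {K : Type*} [RCLike K] (G : TField m k h (FSeries m K)) :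
    TField m k h (FSeries m ℂ) :=
  fun a b => MvPowerSeries.map (toComplexHom K) (G a b)

/-! ### Analytic objects -/

/-- The partial derivative of a function on `K^m`. -/
def partialDeriv {m : ℕ} {K : Type*} [RCLike K] (i : Fin m) (f : (Fin m → K) → K) :
    (Fin m → K) → K :=
  fun x => fderiv K f x (Pi.single i 1)

/-- The Taylor series at the origin: the coefficient of `x^n` is `∂^n f (0) / n!`. -/
def taylorSeries {m : ℕ} {K : Type*} [RCLike K] (f : (Fin m → K) → K) : FSeries m K :=
  fun n => (List.finRange m).foldr (fun i g => (partialDeriv i)^[n i] g) f 0 /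
    ∏ i, (Nat.factorial (n i) : K)

/-- The Taylor series of a vector field. -/
def VField.taylor {m : ℕ} {K : Type*} [RCLike K] (X : VField m ((Fin m → K) → K)) :
    VField m (FSeries m K) :=
  fun i => taylorSeries (X i)

/-- The Taylor series of a tensor field. -/
def TField.taylor {m k h : ℕ} {K : Type*} [RCLike K] (G : TField m k h ((Fin m → K) → K)) :
    TField m k h (FSeries m K) :=
  fun a b => taylorSeries (G a b)

end

/-! Preservation. A formal change of coordinates turns `X` into a normal form `Y = Y^s + Z`, where
`Z` commutes with `Y^s` and has nilpotent linear part, and turns the tensor field into some `G'`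
with `L_Y G' = 0` (`lieDerivCoord_formalPullback`). On a term `x^n ∂_a ⊗ dx_b` the operator `W =
L_{Y^s}` acts by the scalar `⟨γ, n⟩ - ∑ γ_a + ∑ γ_b`, its weight. The operator `L_Z` is
topologically nilpotent: some power of it pushes a given tensor field beyond any prescribed order
(`exists_lieEnd_pow_mem`). Since `W` and `L_Z` commute and `W G' = -L_Z G'`, one gets `W^p G' =
(-1)^p L_Z^p G'`, so each term of nonzero weight vanishes (`coeff_eq_zero_of_lieEnd_eq_zero`).
Inserting `γ = ∑ α_r ρ^r`, weight zero becomes a relation `∑ α_r c_r = 0` with integers `c_r`.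
Minimality of the toric degree forces every `c_r = 0`
(`IsIntegralDecomposition.eq_zero_of_relation`), and the `c_r` are exactly the exponents with which
the torus acts on the term. Hence each surviving term is fixed by the torus. Existence. `X` acts on
the finite-dimensional spaces of jets, and generalized eigenvectors lift from one jet space to the
next. Lifting a basis of generalized eigenvectors among the linear forms gives formal coordinates
`y_i` which are generalized eigenfunctions. Then `X(y_i)` has the same generalized eigenvalue as
`y_i`, hence contains only resonant monomials: this is the Poincaré–Dulac form
(`exists_poincareDulac`). A `ℤ`-basis of the group generated by the eigenvalues gives a minimal
decomposition with effective torus action. The real and the analytic statements reduce to the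
complex formal one, because the Lie derivative is natural under ring homomorphisms commuting with
the partial derivatives. -/

/-! ### The filtration by the order of vanishing -/

/-- The ideal of the series all of whose terms have degree at least `q`. -/
def vanishIdeal (m : ℕ) (K : Type*) [CommRing K] (q : ℕ) : Ideal (FSeries m K) where
  carrier := {f | ∀ n : Fin m →₀ ℕ, n.degree < q → MvPowerSeries.coeff n f = 0}
  zero_mem' := fun _ _ => by simp
  add_mem' := fun {f g} hf hg n hn => by rw [map_add, hf n hn, hg n hn, add_zero]
  smul_mem' := fun c f hf n hn => by
    classical
    rw [smul_eq_mul, MvPowerSeries.coeff_mul]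
    refine Finset.sum_eq_zero fun p hp => ?_
    have h : p.2.degree ≤ n.degree := by
      rw [← Finset.HasAntidiagonal.mem_antidiagonal.1 hp, map_add]; omega
    rw [hf p.2 (by omega), mul_zero]

section Filtration

variable {m : ℕ} {K : Type*} [CommRing K]

theorem mem_vanishIdeal {q : ℕ} {f : FSeries m K} :
    f ∈ vanishIdeal m K q ↔ ∀ n : Fin m →₀ ℕ, n.degree < q → MvPowerSeries.coeff n f = 0 :=
  Iff.rfl

theorem mem_vanishIdeal_iff_le_order {q : ℕ} {f : FSeries m K} :
    f ∈ vanishIdeal m K q ↔ (q : ℕ∞) ≤ f.order := by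
  rw [mem_vanishIdeal]
  constructor
  · exact fun h => MvPowerSeries.nat_le_order h
  · exact fun h n hn => MvPowerSeries.coeff_of_lt_order
      (lt_of_lt_of_le (by exact_mod_cast hn) h)

theorem mem_vanishIdeal_zero (f : FSeries m K) : f ∈ vanishIdeal m K 0 :=
  fun _ hn => absurd hn (Nat.not_lt_zero _)

theorem mem_vanishIdeal_one {f : FSeries m K} :
    f ∈ vanishIdeal m K 1 ↔ MvPowerSeries.constantCoeff f = 0 := by
  rw [mem_vanishIdeal]
  constructor
  · intro h
    simpa using h 0 (by simp)
  · intro h _ hn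
    rw [Nat.lt_one_iff, Finsupp.degree_eq_zero_iff] at hn
    rw [hn]; simpa using h

theorem vanishIdeal_anti {p q : ℕ} (h : p ≤ q) : vanishIdeal m K q ≤ vanishIdeal m K p :=
  fun _ hf n hn => hf n (by omega)

theorem mul_mem_vanishIdeal {p q : ℕ} {f g : FSeries m K} (hf : f ∈ vanishIdeal m K p)
    (hg : g ∈ vanishIdeal m K q) : f * g ∈ vanishIdeal m K (p + q) := by
  rw [mem_vanishIdeal_iff_le_order] at *
  push_cast
  exact (add_le_add hf hg).trans MvPowerSeries.le_order_mul

theorem eq_zero_of_forall_mem_vanishIdeal {f : FSeries m K} (h : ∀ q, f ∈ vanishIdeal m K q) :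
    f = 0 := by
  ext n
  exact h (n.degree + 1) n (by omega)

theorem C_mul_mem_vanishIdeal {q : ℕ} (c : K) {f : FSeries m K} (hf : f ∈ vanishIdeal m K q) :
    MvPowerSeries.C c * f ∈ vanishIdeal m K q :=
  Ideal.mul_mem_left _ _ hf

theorem smul_mem_vanishIdeal {q : ℕ} (c : K) {f : FSeries m K} (hf : f ∈ vanishIdeal m K q) :
    c • f ∈ vanishIdeal m K q := by
  rw [MvPowerSeries.smul_eq_C_mul]; exact C_mul_mem_vanishIdeal c hf

theorem X_mem_vanishIdeal (i : Fin m) :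
    (MvPowerSeries.X i : FSeries m K) ∈ vanishIdeal m K 1 := by
  rw [mem_vanishIdeal_one]; simp

theorem monomial_mem_vanishIdeal (n : Fin m →₀ ℕ) (c : K) :
    (MvPowerSeries.monomial n c : FSeries m K) ∈ vanishIdeal m K n.degree := by
  classical
  intro k hk
  rw [MvPowerSeries.coeff_monomial, if_neg]
  rintro rfl; omega

theorem pderiv_mem_vanishIdeal {q : ℕ} (i : Fin m) {f : FSeries m K}
    (hf : f ∈ vanishIdeal m K (q + 1)) : MvPowerSeries.pderiv K i f ∈ vanishIdeal m K q := by
  intro n hn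
  rw [MvPowerSeries.coeff_pderiv, hf _ (by simp [map_add]; omega), zero_mul]

theorem pderiv_mem_vanishIdeal_pred {q : ℕ} (i : Fin m) {f : FSeries m K}
    (hf : f ∈ vanishIdeal m K q) : MvPowerSeries.pderiv K i f ∈ vanishIdeal m K (q - 1) := by
  cases q with
  | zero => exact mem_vanishIdeal_zero _
  | succ q => exact pderiv_mem_vanishIdeal i hf

/-- Multi-indices of degree less than `q`. -/
def lowIndices (m q : ℕ) : Finset (Fin m →₀ ℕ) :=
  (Finset.range q).biUnion fun d => Finset.finsuppAntidiag Finset.univ d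

theorem mem_lowIndices {q : ℕ} {n : Fin m →₀ ℕ} : n ∈ lowIndices m q ↔ n.degree < q := by
  simp [lowIndices, Finsupp.degree_eq_sum]

/-- The Taylor polynomial of a series, up to the degree `q` (excluded). -/
noncomputable def truncPoly (q : ℕ) (f : FSeries m K) : MvPolynomial (Fin m) K :=
  ∑ n ∈ lowIndices m q, MvPolynomial.monomial n (MvPowerSeries.coeff n f)

theorem truncPoly_coe (q : ℕ) (f : FSeries m K) : (truncPoly q f : FSeries m K) =
    ∑ n ∈ lowIndices m q, MvPowerSeries.coeff n f • MvPowerSeries.monomial n (1 : K) := by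
  have hc := map_sum (MvPolynomial.coeToMvPowerSeries.ringHom (σ := Fin m) (R := K))
    (fun n => MvPolynomial.monomial n (MvPowerSeries.coeff n f)) (lowIndices m q)
  refine hc.trans (Finset.sum_congr rfl fun n _ => ?_)
  rw [MvPolynomial.coeToMvPowerSeries.ringHom_apply, MvPolynomial.coe_monomial, ← map_smul,
    smul_eq_mul, mul_one]

theorem sub_truncPoly_mem (q : ℕ) (f : FSeries m K) :
    f - (truncPoly q f : FSeries m K) ∈ vanishIdeal m K q := by
  classical
  intro n hn
  rw [map_sub, MvPolynomial.coeff_coe, truncPoly, MvPolynomial.coeff_sum]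
  simp [MvPolynomial.coeff_monomial, mem_lowIndices, hn]

/-- Additive maps with a bounded loss of order of vanishing are determined by their values on
polynomials. -/
theorem addHom_eq_of_eq_on_polynomials {m' : ℕ} (F G : FSeries m K →+ FSeries m' K)
    (hF : ∀ q f, f ∈ vanishIdeal m K (q + 1) → F f ∈ vanishIdeal m' K q)
    (hG : ∀ q f, f ∈ vanishIdeal m K (q + 1) → G f ∈ vanishIdeal m' K q)
    (h : ∀ p : MvPolynomial (Fin m) K, F p = G p) (f : FSeries m K) : F f = G f := by
  rw [← sub_eq_zero]
  refine eq_zero_of_forall_mem_vanishIdeal fun q => ?_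
  have hf := sub_truncPoly_mem (q + 1) f
  have : F f - G f = F (f - truncPoly (q + 1) f) - G (f - truncPoly (q + 1) f) := by
    rw [map_sub, map_sub, h]; abel
  rw [this]
  exact sub_mem (hF _ _ hf) (hG _ _ hf)

/-- Completeness: a sequence whose steps vanish to increasing order converges. -/
theorem exists_limit_of_steps {s : ℕ → FSeries m K} {q₀ : ℕ}
    (h : ∀ q, q₀ ≤ q → s (q + 1) - s q ∈ vanishIdeal m K q) :
    ∃ f : FSeries m K, ∀ q, q₀ ≤ q → f - s q ∈ vanishIdeal m K q := by
  have hs : ∀ q, q₀ ≤ q → ∀ r, s (q + r) - s q ∈ vanishIdeal m K q := by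
    intro q hq r
    induction r with
    | zero => simp
    | succ r ih =>
      have := add_mem (vanishIdeal_anti (by omega) (h (q + r) (by omega))) ih
      rwa [sub_add_sub_cancel] at this
  -- From index `n.degree + 1` on, the steps no longer affect the coefficient at `n`; adding `q₀`
  -- puts the index in the range where the hypothesis applies.
  refine ⟨fun n => MvPowerSeries.coeff n (s (q₀ + n.degree + 1)), fun q hq n hn => ?_⟩
  have h1 : MvPowerSeries.coeff n (s (q₀ + q)) = MvPowerSeries.coeff n (s q) := by
    have := hs q hq q₀ n hn
    rwa [map_sub, sub_eq_zero, add_comm] at this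
  have h2 : MvPowerSeries.coeff n (s (q₀ + q)) =
      MvPowerSeries.coeff n (s (q₀ + n.degree + 1)) := by
    obtain ⟨r, rfl⟩ := Nat.exists_eq_add_of_lt hn
    have := hs (q₀ + n.degree + 1) (by omega) r n (by omega)
    rw [map_sub, sub_eq_zero] at this
    rw [← this]; congr 2; omega
  have h3 : MvPowerSeries.coeff n
      ((fun n => MvPowerSeries.coeff n (s (q₀ + n.degree + 1)) : FSeries m K)) =
      MvPowerSeries.coeff n (s (q₀ + n.degree + 1)) := rfl
  exact (map_sub _ _ _).trans (sub_eq_zero.2 (h3.trans (h2.symm.trans h1)))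

end Filtration

/-! ### Substitution of formal maps -/

section Subst

variable {m : ℕ} {K : Type*} [CommRing K]

theorem FixesOrigin.hasSubst {φ : Fin m → FSeries m K} (hφ : FixesOrigin φ) :
    MvPowerSeries.HasSubst φ :=
  MvPowerSeries.hasSubst_of_constantCoeff_zero hφ

theorem FixesOrigin.mem_vanishIdeal {φ : Fin m → FSeries m K} (hφ : FixesOrigin φ) (i : Fin m) :
    φ i ∈ vanishIdeal m K 1 := mem_vanishIdeal_one.2 (hφ i)

theorem subst_mem_vanishIdeal {φ : Fin m → FSeries m K} (hφ : FixesOrigin φ) {q : ℕ}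
    {f : FSeries m K} (hf : f ∈ vanishIdeal m K q) :
    MvPowerSeries.subst φ f ∈ vanishIdeal m K q := by
  rw [mem_vanishIdeal_iff_le_order] at *
  refine le_trans ?_ (MvPowerSeries.le_order_subst hφ.hasSubst f)
  have h1 : (1 : ℕ∞) ≤ ⨅ i, (φ i).order :=
    le_iInf fun i => by exact_mod_cast mem_vanishIdeal_iff_le_order.1 (hφ.mem_vanishIdeal i)
  calc (q : ℕ∞) ≤ f.order := hf
    _ = 1 * f.order := (one_mul _).symm
    _ ≤ _ := by gcongr

theorem FixesOrigin.formalComp {φ ψ : Fin m → FSeries m K} (hφ : FixesOrigin φ)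
    (hψ : FixesOrigin ψ) : FixesOrigin (formalComp φ ψ) := fun i =>
  mem_vanishIdeal_one.1 (subst_mem_vanishIdeal hψ (hφ.mem_vanishIdeal i))

theorem subst_formalComp {φ ψ : Fin m → FSeries m K} (hφ : FixesOrigin φ)
    (hψ : FixesOrigin ψ) (f : FSeries m K) :
    MvPowerSeries.subst (formalComp φ ψ) f = MvPowerSeries.subst ψ (MvPowerSeries.subst φ f) :=
  (MvPowerSeries.subst_comp_subst_apply hφ.hasSubst hψ.hasSubst f).symm

theorem formalComp_assoc (φ : Fin m → FSeries m K) {ψ χ : Fin m → FSeries m K}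
    (hψ : FixesOrigin ψ) (hχ : FixesOrigin χ) :
    formalComp (formalComp φ ψ) χ = formalComp φ (formalComp ψ χ) := by
  funext i
  exact (subst_formalComp hψ hχ (φ i)).symm

theorem subst_formalId (f : FSeries m K) : MvPowerSeries.subst (formalId m K) f = f := by
  have := MvPowerSeries.subst_self (σ := Fin m) (R := K)
  exact congrFun this f

theorem formalComp_formalId (φ : Fin m → FSeries m K) : formalComp φ (formalId m K) = φ := by
  funext i; exact subst_formalId _

theorem formalId_formalComp {φ : Fin m → FSeries m K} (hφ : FixesOrigin φ) :
    formalComp (formalId m K) φ = φ := by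
  funext i; exact MvPowerSeries.subst_X hφ.hasSubst i

theorem subst_sum {φ : Fin m → FSeries m K} (hφ : FixesOrigin φ) {ι : Type*} (s : Finset ι)
    (f : ι → FSeries m K) :
    MvPowerSeries.subst φ (∑ i ∈ s, f i) = ∑ i ∈ s, MvPowerSeries.subst φ (f i) := by
  simp only [← MvPowerSeries.substAlgHom_apply (R := K) hφ.hasSubst, map_sum]

/-- The chain rule. -/
theorem pderiv_subst {φ : Fin m → FSeries m K} (hφ : FixesOrigin φ) (i : Fin m)
    (f : FSeries m K) :
    MvPowerSeries.pderiv K i (MvPowerSeries.subst φ f) =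
      ∑ l, MvPowerSeries.subst φ (MvPowerSeries.pderiv K l f) *
        MvPowerSeries.pderiv K i (φ l) := by
  let S : FSeries m K →+ FSeries m K := (MvPowerSeries.substAlgHom (R := K) hφ.hasSubst)
  have hS : ∀ f, S f = MvPowerSeries.subst φ f := fun f =>
    MvPowerSeries.substAlgHom_apply hφ.hasSubst f
  let F : FSeries m K →+ FSeries m K :=
    (MvPowerSeries.pderiv K i).toLinearMap.toAddMonoidHom.comp S
  let G : FSeries m K →+ FSeries m K := ∑ l,
    (AddMonoidHom.mulRight (MvPowerSeries.pderiv K i (φ l))).comp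
      (S.comp (MvPowerSeries.pderiv K l).toLinearMap.toAddMonoidHom)
  have hFd : ∀ f, F f = MvPowerSeries.pderiv K i (MvPowerSeries.subst φ f) := fun f => by
    rw [← hS]; rfl
  have hGd : ∀ f, G f = ∑ l, MvPowerSeries.subst φ (MvPowerSeries.pderiv K l f) *
        MvPowerSeries.pderiv K i (φ l) := fun f => by
    simp only [← hS, G, AddMonoidHom.finsetSum_apply]; rfl
  rw [← hFd, ← hGd]
  -- Substitution keeps the order of vanishing and a derivative loses one, so both sides are
  -- determined by polynomials, where the Leibniz rule gives an induction.
  refine addHom_eq_of_eq_on_polynomials F G ?_ ?_ ?_ f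
  · intro q f hf
    rw [hFd]
    exact pderiv_mem_vanishIdeal i (subst_mem_vanishIdeal hφ hf)
  · intro q f hf
    rw [hGd]
    exact sum_mem fun l _ =>
      Ideal.mul_mem_right _ _ (subst_mem_vanishIdeal hφ (pderiv_mem_vanishIdeal l hf))
  · intro p
    rw [hFd, hGd]
    have hs := hφ.hasSubst
    induction p using MvPolynomial.induction_on with
    | C a =>
      have h0 : ∀ l : Fin m, MvPowerSeries.pderiv K l (MvPowerSeries.C (σ := Fin m) a) = 0 :=
        fun l => MvPowerSeries.pderiv_C
      have h1 : MvPowerSeries.subst φ (MvPowerSeries.C (σ := Fin m) a) = MvPowerSeries.C a :=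
        MvPowerSeries.subst_C a
      have h2 : MvPowerSeries.subst φ (0 : FSeries m K) = 0 := by rw [← hS, map_zero]
      simp only [MvPolynomial.coe_C, h0, h1, h2, zero_mul, Finset.sum_const_zero]
    | add p q hp hq =>
      simp only [MvPolynomial.coe_add, MvPowerSeries.subst_add hs, map_add, hp, hq, add_mul,
        Finset.sum_add_distrib]
    | mul_X p j hp =>
      have h2 : MvPowerSeries.subst φ (0 : FSeries m K) = 0 := by rw [← hS, map_zero]
      have h3 : MvPowerSeries.subst φ (1 : FSeries m K) = 1 :=
        (MvPowerSeries.substAlgHom_apply hs 1).symm.trans (map_one _)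
      simp only [MvPolynomial.coe_mul, MvPolynomial.coe_X, MvPowerSeries.subst_mul hs,
        Derivation.leibniz, hp, smul_eq_mul, MvPowerSeries.subst_X hs,
        MvPowerSeries.subst_add hs, add_mul, Finset.sum_add_distrib, Finset.mul_sum]
      congr 1
      · rw [Finset.sum_eq_single j]
        · rw [MvPowerSeries.pderiv_X_self, h3, mul_one]
        · intro l _ hl
          rw [MvPowerSeries.pderiv_X_of_ne (Ne.symm hl), h2, mul_zero, zero_mul]
        · simp
      · exact Finset.sum_congr rfl fun l _ => by ring

end Subst

/-! ### Jacobians and the formal inverse function theorem -/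

section Inverse

variable {m : ℕ} {K : Type*} [CommRing K]

theorem subst_one {φ : Fin m → FSeries m K} (hφ : FixesOrigin φ) :
    MvPowerSeries.subst φ (1 : FSeries m K) = 1 :=
  (MvPowerSeries.substAlgHom_apply (R := K) hφ.hasSubst 1).symm.trans (map_one _)

theorem subst_zero' {φ : Fin m → FSeries m K} (hφ : FixesOrigin φ) :
    MvPowerSeries.subst φ (0 : FSeries m K) = 0 :=
  (MvPowerSeries.substAlgHom_apply (R := K) hφ.hasSubst 0).symm.trans (map_zero _)

theorem subst_C_mul {φ : Fin m → FSeries m K} (hφ : FixesOrigin φ) (c : K) (f : FSeries m K) :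
    MvPowerSeries.subst φ (MvPowerSeries.C c * f) =
      MvPowerSeries.C c * MvPowerSeries.subst φ f := by
  rw [MvPowerSeries.subst_mul hφ.hasSubst]
  congr 1
  exact MvPowerSeries.subst_C c

theorem constantCoeff_subst_of_fixesOrigin {φ : Fin m → FSeries m K} (hφ : FixesOrigin φ)
    (f : FSeries m K) :
    MvPowerSeries.constantCoeff (MvPowerSeries.subst φ f) = MvPowerSeries.constantCoeff f := by
  set c := MvPowerSeries.constantCoeff f with hc
  have h1 : f - MvPowerSeries.C c ∈ vanishIdeal m K 1 := by
    rw [mem_vanishIdeal_one]; simp [hc]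
  have h2 := subst_mem_vanishIdeal hφ h1
  have h3 : MvPowerSeries.subst φ (MvPowerSeries.C (σ := Fin m) c) = MvPowerSeries.C c :=
    MvPowerSeries.subst_C c
  rw [MvPowerSeries.subst_sub hφ.hasSubst, h3, mem_vanishIdeal_one] at h2
  simpa [sub_eq_zero] using h2

theorem formalJacobian_formalComp (φ : Fin m → FSeries m K) {ψ : Fin m → FSeries m K}
    (hψ : FixesOrigin ψ) :
    formalJacobian (formalComp φ ψ) =
      (formalJacobian φ).map (MvPowerSeries.subst ψ) * formalJacobian ψ := by
  ext1 i j
  simp only [formalJacobian, formalComp, formalPartial, Matrix.of_apply, Matrix.mul_apply,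
    Matrix.map_apply, pderiv_subst hψ]

theorem formalJacobian_formalId : formalJacobian (formalId m K) = 1 := by
  ext1 i j
  simp only [formalJacobian, formalId, formalPartial, Matrix.of_apply, Matrix.one_apply,
    MvPowerSeries.pderiv_X, Pi.single_apply]

theorem linearPart_eq (φ : Fin m → FSeries m K) :
    linearPart φ = (formalJacobian φ).map MvPowerSeries.constantCoeff := by
  ext1 i j
  simp only [linearPart, formalJacobian, formalPartial, Matrix.of_apply, Matrix.map_apply]
  rw [← MvPowerSeries.coeff_zero_eq_constantCoeff_apply, MvPowerSeries.coeff_pderiv]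
  simp

theorem linearPart_formalComp (φ : Fin m → FSeries m K) {ψ : Fin m → FSeries m K}
    (hψ : FixesOrigin ψ) : linearPart (formalComp φ ψ) = linearPart φ * linearPart ψ := by
  rw [linearPart_eq, linearPart_eq, linearPart_eq, formalJacobian_formalComp φ hψ, Matrix.map_mul]
  congr 1
  ext1 i j
  simp only [Matrix.map_apply, constantCoeff_subst_of_fixesOrigin hψ]

theorem linearPart_formalId : linearPart (formalId m K) = 1 := by
  rw [linearPart_eq, formalJacobian_formalId]
  exact Matrix.map_one _ (map_zero _) (map_one _)

/-- A series vanishing at the origin is its linear part up to terms of order two. -/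
theorem sub_linear_mem_vanishIdeal {f : FSeries m K} (hf : MvPowerSeries.constantCoeff f = 0) :
    f - ∑ j, MvPowerSeries.C (MvPowerSeries.coeff (Finsupp.single j 1) f) * MvPowerSeries.X j ∈
      vanishIdeal m K 2 := by
  classical
  intro n hn
  simp only [map_sub, map_sum, MvPowerSeries.coeff_C_mul, MvPowerSeries.coeff_X]
  rcases Nat.lt_succ_iff_lt_or_eq.1 hn with h0 | h1
  · rw [Nat.lt_one_iff, Finsupp.degree_eq_zero_iff] at h0
    subst h0
    rw [MvPowerSeries.coeff_zero_eq_constantCoeff_apply, hf, zero_sub, neg_eq_zero]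
    refine Finset.sum_eq_zero fun j _ => ?_
    rw [if_neg, mul_zero]
    intro h
    have := congrArg (fun k => k j) h
    simp at this
  · obtain ⟨j, rfl⟩ := (Finsupp.sum_eq_one_iff n).1 h1
    rw [sub_eq_zero, Finset.sum_eq_single j]
    · simp
    · intro l _ hl
      rw [if_neg, mul_zero]
      intro h
      exact hl (Finsupp.single_left_injective one_ne_zero h).symm
    · simp

/-- A map tangent to the identity acts trivially on the graded pieces of the filtration. This is
assumed for the coordinates, and `ab - cd = a(b - d) + (a - c)d` carries it over to products, hence
to monomials. -/
theorem subst_sub_self_mem_vanishIdeal {χ : Fin m → FSeries m K} (hχ : FixesOrigin χ)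
    (h : ∀ i, χ i - MvPowerSeries.X i ∈ vanishIdeal m K 2) {q : ℕ} {f : FSeries m K}
    (hf : f ∈ vanishIdeal m K q) :
    MvPowerSeries.subst χ f - f ∈ vanishIdeal m K (q + 1) := by
  have hs := hχ.hasSubst
  have hmul : ∀ (p r : ℕ) (f g : FSeries m K), f ∈ vanishIdeal m K p → g ∈ vanishIdeal m K r →
      MvPowerSeries.subst χ f - f ∈ vanishIdeal m K (p + 1) →
      MvPowerSeries.subst χ g - g ∈ vanishIdeal m K (r + 1) →
      MvPowerSeries.subst χ (f * g) - f * g ∈ vanishIdeal m K (p + r + 1) := by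
    intro p r f g hf hg hf' hg'
    rw [MvPowerSeries.subst_mul hs]
    have h1 := mul_mem_vanishIdeal (subst_mem_vanishIdeal hχ hf) hg'
    have h2 := mul_mem_vanishIdeal hf' hg
    rw [show p + 1 + r = p + (r + 1) by omega] at h2
    have h3 : ∀ a b c d : FSeries m K, a * b - c * d = a * (b - d) + (a - c) * d :=
      fun a b c d => by ring
    rw [h3]
    exact add_mem h1 h2
  have hmon : ∀ n : Fin m →₀ ℕ,
      MvPowerSeries.subst χ (MvPowerSeries.monomial n (1 : K)) - MvPowerSeries.monomial n 1 ∈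
        vanishIdeal m K (n.degree + 1) := by
    intro n
    induction n using Finsupp.induction_linear with
    | zero =>
      rw [MvPowerSeries.monomial_zero_eq_C_apply, map_one, subst_one hχ, sub_self]
      exact zero_mem _
    | add a b ha hb =>
      have := hmul _ _ _ _ (monomial_mem_vanishIdeal a 1) (monomial_mem_vanishIdeal b 1) ha hb
      rwa [MvPowerSeries.monomial_mul_monomial, one_mul, ← map_add Finsupp.degree] at this
    | single i d =>
      rw [Finsupp.degree_single]
      induction d with
      | zero =>
        rw [Finsupp.single_zero, MvPowerSeries.monomial_zero_eq_C_apply, map_one, subst_one hχ,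
          sub_self]
        exact zero_mem _
      | succ d ih =>
        have hd := monomial_mem_vanishIdeal (Finsupp.single i d) (1 : K)
        rw [Finsupp.degree_single] at hd
        have := hmul d 1 _ _ hd (X_mem_vanishIdeal i) ih
          (by rw [MvPowerSeries.subst_X hs]; exact h i)
        rwa [MvPowerSeries.X_def, MvPowerSeries.monomial_mul_monomial, one_mul,
          ← Finsupp.single_add] at this
  have h1 := sub_truncPoly_mem (q + 1) f
  have h2 := subst_mem_vanishIdeal hχ h1
  have h3 : MvPowerSeries.subst χ (truncPoly (q + 1) f : FSeries m K) -
      (truncPoly (q + 1) f : FSeries m K) ∈ vanishIdeal m K (q + 1) := by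
    rw [truncPoly_coe, subst_sum hχ, ← Finset.sum_sub_distrib]
    refine sum_mem fun n hn => ?_
    rw [MvPowerSeries.smul_eq_C_mul, subst_C_mul hχ, ← mul_sub]
    -- The truncation contains only degrees at most `q`, and those below `q` have zero coefficient
    -- in `f`; only degree exactly `q` remains.
    by_cases hnq : n.degree < q
    · rw [hf n hnq, map_zero, zero_mul]; exact zero_mem _
    · have : n.degree = q := by have := mem_lowIndices.1 hn; omega
      exact C_mul_mem_vanishIdeal _ (this ▸ hmon n)
  have := add_mem (sub_mem h2 h1) h3
  rw [MvPowerSeries.subst_sub hs] at this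
  convert this using 1
  abel

/-- With `l` the inverse of the linear part, `l ∘ φ` is tangent to the identity, so `subst l`
inverts `subst φ` up to one higher order. Iteration makes `subst φ` surjective, and preimages of the
coordinates are the components of `ψ`. -/
theorem exists_formalComp_eq_formalId_of_isUnit {φ : Fin m → FSeries m K} (hφ : FixesOrigin φ)
    (hu : IsUnit (linearPart φ)) :
    ∃ ψ : Fin m → FSeries m K, FixesOrigin ψ ∧ formalComp ψ φ = formalId m K := by
  obtain ⟨u, hu⟩ := hu
  let Q : Matrix (Fin m) (Fin m) K := ↑u⁻¹
  have hQ : Q * linearPart φ = 1 := by rw [← hu]; exact u.inv_mul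
  let l : Fin m → FSeries m K := fun i => ∑ j, MvPowerSeries.C (Q i j) * MvPowerSeries.X j
  have hl : FixesOrigin l := fun i => by simp [l]
  have hlφ : ∀ i, formalComp l φ i - MvPowerSeries.X i ∈ vanishIdeal m K 2 := by
    intro i
    have h1 : formalComp l φ i = ∑ j, MvPowerSeries.C (Q i j) * φ j := by
      simp only [formalComp, l, subst_sum hφ, subst_C_mul hφ, MvPowerSeries.subst_X hφ.hasSubst]
    have h2 : (MvPowerSeries.X i : FSeries m K) = ∑ j, MvPowerSeries.C (Q i j) *
        ∑ k, MvPowerSeries.C (linearPart φ j k) * MvPowerSeries.X k := by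
      simp only [Finset.mul_sum]
      rw [Finset.sum_comm]
      simp only [← mul_assoc, ← Finset.sum_mul, ← map_mul, ← map_sum, ← Matrix.mul_apply, hQ]
      simp [Matrix.one_apply]
    rw [h1, h2, ← Finset.sum_sub_distrib]
    refine sum_mem fun j _ => ?_
    rw [← mul_sub]
    exact C_mul_mem_vanishIdeal _ (sub_linear_mem_vanishIdeal (hφ j))
  have key : ∀ q (f : FSeries m K), f ∈ vanishIdeal m K q →
      f - MvPowerSeries.subst φ (MvPowerSeries.subst l f) ∈ vanishIdeal m K (q + 1) := by
    intro q f hf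
    rw [← subst_formalComp hl hφ, ← neg_sub]
    exact neg_mem (subst_sub_self_mem_vanishIdeal (hl.formalComp hφ) hlφ hf)
  have surj : ∀ f : FSeries m K, ∃ g : FSeries m K, MvPowerSeries.subst φ g = f := by
    intro f
    -- Successive approximation: the residual is corrected by its image under `subst l`, and by
    -- `key` each correction gains one order.
    let s : ℕ → FSeries m K := fun q => Nat.rec 0
      (fun _ g => g + MvPowerSeries.subst l (f - MvPowerSeries.subst φ g)) q
    have hs : ∀ q, s (q + 1) = s q + MvPowerSeries.subst l (f - MvPowerSeries.subst φ (s q)) :=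
      fun q => rfl
    have hf : ∀ q, f - MvPowerSeries.subst φ (s q) ∈ vanishIdeal m K q := by
      intro q
      induction q with
      | zero => exact mem_vanishIdeal_zero _
      | succ q ih =>
        rw [hs, MvPowerSeries.subst_add hφ.hasSubst, ← sub_sub]
        exact key q _ ih
    obtain ⟨g, hg⟩ := exists_limit_of_steps (s := s) (q₀ := 0) fun q _ => by
      rw [hs, add_sub_cancel_left]
      exact subst_mem_vanishIdeal hl (hf q)
    refine ⟨g, (sub_eq_zero.1 (eq_zero_of_forall_mem_vanishIdeal fun q => ?_)).symm⟩
    have := sub_mem (hf q) (subst_mem_vanishIdeal hφ (hg q (Nat.zero_le q)))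
    rw [MvPowerSeries.subst_sub hφ.hasSubst] at this
    convert this using 1
    abel
  choose g hg using surj
  refine ⟨fun i => g (MvPowerSeries.X i), fun i => ?_, funext fun i => hg _⟩
  rw [← constantCoeff_subst_of_fixesOrigin hφ, hg]
  simp

/-- The formal inverse function theorem. -/
theorem isFormalDiffeo_of_isUnit_linearPart {φ : Fin m → FSeries m K} (hφ : FixesOrigin φ)
    (hu : IsUnit (linearPart φ)) : IsFormalDiffeo φ := by
  obtain ⟨ψ, hψ, h⟩ := exists_formalComp_eq_formalId_of_isUnit hφ hu
  have hl : linearPart ψ * linearPart φ = 1 := by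
    rw [← linearPart_formalComp ψ hφ, h, linearPart_formalId]
  -- `ψ` has invertible linear part as well, so it too has an inverse on the other side, and the two
  -- one-sided inverses of `ψ` agree.
  obtain ⟨χ, hχ, h'⟩ := exists_formalComp_eq_formalId_of_isUnit hψ
    (IsUnit.of_mul_eq_one _ hl)
  have : χ = φ := by
    rw [← formalComp_formalId χ, ← h, ← formalComp_assoc χ hψ hφ, h', formalId_formalComp hφ]
  exact ⟨hφ, ψ, hψ, this ▸ h', h⟩

end Inverse

theorem derivation_prod {ι A R : Type*} [DecidableEq ι] [CommRing R] [CommRing A]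
    [Algebra A R] (δ : Derivation A R R)
    (s : Finset ι) (f : ι → R) :
    δ (∏ i ∈ s, f i) = ∑ i ∈ s, δ (f i) * ∏ j ∈ s.erase i, f j := by
  induction s using Finset.induction_on with
  | empty => simp
  | insert a s ha ih =>
    rw [Finset.prod_insert ha, Derivation.leibniz, ih, Finset.sum_insert ha,
      Finset.erase_insert ha, smul_eq_mul, smul_eq_mul, Finset.mul_sum, add_comm, mul_comm]
    congr 1
    refine Finset.sum_congr rfl fun i hi => ?_
    have hia : a ≠ i := fun h => ha (h ▸ hi)
    rw [Finset.erase_insert_of_ne hia, Finset.prod_insert (fun h => ha (Finset.mem_of_mem_erase h))]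
    ring

/-! ### Linear operations on all the indices of a tensor

`ι` is the set of the slots of the tensor, `σ` the set of the values of an index. -/

section Slots

variable {ι σ R : Type*} [Fintype ι] [DecidableEq ι] [Fintype σ] [CommRing R]

/-- The matrix `P s` acts on the index in the slot `s`, for every `s`. -/
def slotAction (P : ι → Matrix σ σ R) (G : (ι → σ) → R) : (ι → σ) → R :=
  fun c => ∑ c', (∏ s, P s (c s) (c' s)) * G c'

/-- The derivation `δ` on the coefficients plus the sum over the slots `s` of the action of the
matrix `N s` on the index in that slot. -/
def slotDeriv (δ : R → R) (N : ι → Matrix σ σ R) (G : (ι → σ) → R) : (ι → σ) → R :=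
  fun c => δ (G c) + ∑ s, ∑ l, N s (c s) l * G (Function.update c s l)

theorem slotAction_slotAction (P Q : ι → Matrix σ σ R) (G : (ι → σ) → R) :
    slotAction P (slotAction Q G) = slotAction (fun s => P s * Q s) G := by
  funext c
  simp only [slotAction, Matrix.mul_apply, Finset.mul_sum, Finset.prod_univ_sum,
    Fintype.piFinset_univ, Finset.sum_mul]
  rw [Finset.sum_comm]
  simp only [Finset.prod_mul_distrib, mul_assoc]

theorem slotAction_diagonal [DecidableEq σ] (p : ι → σ → R) (G : (ι → σ) → R) (c : ι → σ) :
    slotAction (fun s => Matrix.diagonal (p s)) G c = (∏ s, p s (c s)) * G c := by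
  rw [slotAction, Finset.sum_eq_single c]
  · simp
  · intro c' _ hc
    obtain ⟨s, hs⟩ := Function.ne_iff.1 hc
    rw [Finset.prod_eq_zero (Finset.mem_univ s), zero_mul]
    exact Matrix.diagonal_apply_ne _ (Ne.symm hs)
  · simp

theorem slotAction_one [DecidableEq σ] (G : (ι → σ) → R) :
    slotAction (fun _ => (1 : Matrix σ σ R)) G = G := by
  funext c
  have := slotAction_diagonal (fun (_ : ι) (_ : σ) => (1 : R)) G c
  simpa using this

theorem map_slotAction {S : Type*} [CommRing S] (g : R →+* S) (P : ι → Matrix σ σ R)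
    (G : (ι → σ) → R) :
    (fun c => g (slotAction P G c)) = slotAction (fun s => (P s).map g) (fun c => g (G c)) := by
  funext c; simp [slotAction, map_sum, map_prod]

theorem map_slotDeriv {S : Type*} [CommRing S] (g : R →+* S) {δ : R → R} {δ' : S → S}
    (h : ∀ r, g (δ r) = δ' (g r)) (N : ι → Matrix σ σ R) (G : (ι → σ) → R) :
    (fun c => g (slotDeriv δ N G c)) =
      slotDeriv δ' (fun s => (N s).map g) (fun c => g (G c)) := by
  funext c; simp [slotDeriv, map_sum, h]

/-- `slotDeriv` intertwines `slotAction` as soon as it does so slot by slot. -/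
theorem slotDeriv_slotAction {A : Type*} [CommRing A] [Algebra A R] (δ : Derivation A R R)
    {P N N' : ι → Matrix σ σ R} (h : ∀ s, (P s).map δ + N' s * P s = P s * N s)
    (G : (ι → σ) → R) :
    slotDeriv δ N' (slotAction P G) = slotAction P (slotDeriv δ N G) := by
  funext c
  have hsplit : ∀ (s : ι) (f : ι → R), ∏ r, f r = f s * ∏ r ∈ Finset.univ.erase s, f r :=
    fun s f => (Finset.mul_prod_erase _ _ (Finset.mem_univ s)).symm
  have hleft : ∀ s, ∑ l, N' s (c s) l * slotAction P G (Function.update c s l) =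
      ∑ c', (N' s * P s) (c s) (c' s) * (∏ r ∈ Finset.univ.erase s, P r (c r) (c' r)) * G c' := by
    intro s
    simp only [slotAction, Finset.mul_sum, Matrix.mul_apply, Finset.sum_mul]
    rw [Finset.sum_comm]
    refine Finset.sum_congr rfl fun c' _ => Finset.sum_congr rfl fun l _ => ?_
    rw [hsplit s]
    have : ∏ r ∈ Finset.univ.erase s, P r (Function.update c s l r) (c' r) =
        ∏ r ∈ Finset.univ.erase s, P r (c r) (c' r) :=
      Finset.prod_congr rfl fun r hr => by
        rw [Function.update_of_ne (Finset.ne_of_mem_erase hr)]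
    rw [this, Function.update_self]
    ring
  have hright : ∀ s, ∑ c', (∏ r, P r (c r) (c' r)) *
        ∑ l, N s (c' s) l * G (Function.update c' s l) =
      ∑ c', (P s * N s) (c s) (c' s) * (∏ r ∈ Finset.univ.erase s, P r (c r) (c' r)) * G c' := by
    intro s
    simp only [Finset.mul_sum, Matrix.mul_apply, Finset.sum_mul]
    rw [← Fintype.sum_prod_type', ← Fintype.sum_prod_type']
    -- Exchanging the index in slot `s` with the contracted index is an involution of the set of
    -- summation indices; it moves the substitution from `G` to `P`.
    let e : (ι → σ) × σ → (ι → σ) × σ := fun p => (Function.update p.1 s p.2, p.1 s)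
    have he : Function.Involutive e := fun p => by simp [e]
    refine Fintype.sum_equiv he.toPerm _ _ fun p => ?_
    rw [hsplit s]
    have : ∏ r ∈ Finset.univ.erase s, P r (c r) (Function.update p.1 s p.2 r) =
        ∏ r ∈ Finset.univ.erase s, P r (c r) (p.1 r) :=
      Finset.prod_congr rfl fun r hr => by
        rw [Function.update_of_ne (Finset.ne_of_mem_erase hr)]
    simp only [Function.Involutive.coe_toPerm, e, this, Function.update_self]
    ring
  have hδ : δ (slotAction P G c) = ∑ c', (∏ r, P r (c r) (c' r)) * δ (G c') +
      ∑ s, ∑ c', ((P s).map δ) (c s) (c' s) *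
        (∏ r ∈ Finset.univ.erase s, P r (c r) (c' r)) * G c' := by
    rw [Finset.sum_comm, ← Finset.sum_add_distrib, slotAction, map_sum]
    refine Finset.sum_congr rfl fun c' _ => ?_
    rw [Derivation.leibniz, derivation_prod, smul_eq_mul, smul_eq_mul, mul_comm (G c'),
      Finset.sum_mul]
    rfl
  have hR : slotAction P (slotDeriv δ N G) c = ∑ c', (∏ r, P r (c r) (c' r)) * δ (G c') +
      ∑ s, ∑ c', (∏ r, P r (c r) (c' r)) * ∑ l, N s (c' s) l * G (Function.update c' s l) := by
    rw [Finset.sum_comm, ← Finset.sum_add_distrib]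
    refine Finset.sum_congr rfl fun c' _ => ?_
    rw [slotDeriv, mul_add, Finset.mul_sum Finset.univ]
  rw [hR, slotDeriv, hδ, add_assoc, ← Finset.sum_add_distrib]
  congr 1
  refine Finset.sum_congr rfl fun s _ => ?_
  rw [hleft, hright, ← h s, ← Finset.sum_add_distrib]
  refine Finset.sum_congr rfl fun c' _ => ?_
  rw [Matrix.add_apply]
  ring

end Slots

/-! ### Tensor fields as functions of all their indices -/

section Tensors

variable {m k h : ℕ}

/-- The components of a tensor field, indexed by all the indices at once. -/
def TField.flat {R : Type*} (G : TField m k h R) : (Fin k ⊕ Fin h → Fin m) → R :=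
  fun c => G (c ∘ Sum.inl) (c ∘ Sum.inr)

theorem TField.flat_elim {R : Type*} (G : TField m k h R) (a : Fin k → Fin m)
    (b : Fin h → Fin m) : G.flat (Sum.elim a b) = G a b := by
  simp [TField.flat]

theorem TField.flat_injective {R : Type*} :
    Function.Injective (TField.flat : TField m k h R → _) := by
  intro G G' hG
  funext a b
  rw [← G.flat_elim, hG, G'.flat_elim]

/-- The matrices of the action of a vector field on the slots of a tensor field. -/
def lieSlots {R : Type*} [CommRing R] (D : Fin m → R → R) (X : VField m R) (k h : ℕ) :
    Fin k ⊕ Fin h → Matrix (Fin m) (Fin m) R :=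
  Sum.elim (fun _ => -Matrix.of fun p l => D l (X p)) (fun _ => Matrix.of fun p l => D p (X l))

/-- The matrices of the pull-back on the slots of a tensor field, in terms of the Jacobian. -/
noncomputable def pullbackSlots {R : Type*} [CommRing R] (J : Matrix (Fin m) (Fin m) R)
    (k h : ℕ) : Fin k ⊕ Fin h → Matrix (Fin m) (Fin m) R :=
  Sum.elim (fun _ => J⁻¹) (fun _ => J.transpose)

theorem lieDerivCoord_flat {R : Type*} [CommRing R] (D : Fin m → R → R) (X : VField m R)
    (G : TField m k h R) :
    (lieDerivCoord D X G).flat =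
      slotDeriv (fun f => ∑ l, X l * D l f) (lieSlots D X k h) G.flat := by
  funext c
  obtain ⟨a, b, rfl⟩ : ∃ a b, c = Sum.elim a b := ⟨_, _, (Sum.elim_comp_inl_inr c).symm⟩
  simp only [TField.flat_elim, slotDeriv, lieDerivCoord, Fintype.sum_sum_type, lieSlots,
    Sum.elim_inl, Sum.elim_inr, Sum.update_elim_inl, Sum.update_elim_inr, Matrix.neg_apply,
    Matrix.of_apply, neg_mul, Finset.sum_neg_distrib, mul_comm (G _ _)]
  ring

theorem formalPullback_flat {K : Type*} [CommRing K] (φ : Fin m → FSeries m K)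
    (G : TField m k h (FSeries m K)) :
    (formalPullback φ G).flat =
      slotAction (pullbackSlots (formalJacobian φ) k h)
        (fun c => MvPowerSeries.subst φ (G.flat c)) := by
  funext c
  obtain ⟨a, b, rfl⟩ : ∃ a b, c = Sum.elim a b := ⟨_, _, (Sum.elim_comp_inl_inr c).symm⟩
  rw [TField.flat_elim, formalPullback, slotAction, ← Fintype.sum_prod_type']
  refine Fintype.sum_equiv (Equiv.sumArrowEquivProdArrow _ _ _).symm _ _ fun p => ?_
  simp [pullbackSlots, Fintype.prod_sum_type, Equiv.sumArrowEquivProdArrow, TField.flat_elim]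

end Tensors

/-! ### Naturality of pull-backs and Lie derivatives -/

section Naturality

variable {m k h : ℕ} {K : Type*} [CommRing K]

theorem IsFormalDiffeo.isUnit_formalJacobian {φ : Fin m → FSeries m K} (hφ : IsFormalDiffeo φ) :
    IsUnit (formalJacobian φ) := by
  obtain ⟨hφ0, ψ, hψ, -, h⟩ := hφ
  have := formalJacobian_formalComp ψ hφ0
  rw [h, formalJacobian_formalId] at this
  have h2 : formalJacobian φ * (formalJacobian ψ).map (MvPowerSeries.subst φ) = 1 :=
    mul_eq_one_comm.1 this.symm
  exact IsUnit.of_mul_eq_one _ h2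

theorem Matrix.map_inv_of_isUnit {R S : Type*} [CommRing R] [CommRing S]
    (g : R →+* S) {n : Type*} [Fintype n] [DecidableEq n] {J : Matrix n n R} (hJ : IsUnit J) :
    (J⁻¹).map g = (J.map g)⁻¹ := by
  have h1 : J⁻¹ * J = 1 := Matrix.nonsing_inv_mul J ((Matrix.isUnit_iff_isUnit_det J).1 hJ)
  symm
  apply Matrix.inv_eq_left_inv
  rw [← Matrix.map_mul, h1]
  exact Matrix.map_one _ (map_zero g) (map_one g)

theorem formalPullback_formalComp {φ ψ : Fin m → FSeries m K} (hφ : IsFormalDiffeo φ)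
    (hψ : FixesOrigin ψ) (G : TField m k h (FSeries m K)) :
    formalPullback (formalComp φ ψ) G = formalPullback ψ (formalPullback φ G) := by
  apply TField.flat_injective
  let g : FSeries m K →+* FSeries m K := (MvPowerSeries.substAlgHom (R := K) hψ.hasSubst)
  have hg : ∀ f, MvPowerSeries.subst ψ f = g f := fun f =>
    (MvPowerSeries.substAlgHom_apply hψ.hasSubst f).symm
  have hg' : (MvPowerSeries.subst ψ : FSeries m K → FSeries m K) = g := funext hg
  rw [formalPullback_flat, formalPullback_flat, formalPullback_flat]
  simp only [hg, subst_formalComp hφ.1 hψ]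
  rw [map_slotAction, slotAction_slotAction, formalJacobian_formalComp _ hψ, hg']
  congr 1
  funext s
  rcases s with s | s
  · simp only [pullbackSlots, Sum.elim_inl]
    rw [Matrix.mul_inv_rev, Matrix.map_inv_of_isUnit g hφ.isUnit_formalJacobian]
  · simp only [pullbackSlots, Sum.elim_inr]
    rw [Matrix.transpose_mul, Matrix.transpose_map]

theorem formalPullback_formalId (G : TField m k h (FSeries m K)) :
    formalPullback (formalId m K) G = G := by
  apply TField.flat_injective
  rw [formalPullback_flat, formalJacobian_formalId]
  simp only [subst_formalId]
  have : pullbackSlots (1 : Matrix (Fin m) (Fin m) (FSeries m K)) k h = fun _ => 1 := by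
    funext s; rcases s with s | s <;> simp [pullbackSlots]
  rw [this, slotAction_one]

theorem formalPullback_zero {φ : Fin m → FSeries m K} (hφ : FixesOrigin φ) :
    formalPullback φ (0 : TField m k h (FSeries m K)) = 0 := by
  funext a b
  simp [formalPullback, subst_zero' hφ]

/-- A vector field as a derivation of the ring of formal series. -/
noncomputable def VField.derivation (X : VField m (FSeries m K)) :
    Derivation K (FSeries m K) (FSeries m K) :=
  ∑ l, X l • MvPowerSeries.pderiv K l

theorem VField.derivation_apply (X : VField m (FSeries m K)) (f : FSeries m K) :
    X.derivation f = ∑ l, X l * formalPartial l f := by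
  rw [VField.derivation, ← Derivation.coeFnAddMonoidHom_apply, map_sum, Finset.sum_apply]
  rfl

theorem VField.derivation_X (X : VField m (FSeries m K)) (i : Fin m) :
    X.derivation (MvPowerSeries.X i) = X i := by
  simp [VField.derivation_apply, formalPartial, MvPowerSeries.pderiv_X, Pi.single_apply]

theorem VField.derivation_subst {φ : Fin m → FSeries m K} (hφ : FixesOrigin φ)
    {X Y : VField m (FSeries m K)} (hXY : FormalPushforwardEq φ X Y) (f : FSeries m K) :
    X.derivation (MvPowerSeries.subst φ f) = MvPowerSeries.subst φ (Y.derivation f) := by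
  simp only [VField.derivation_apply, subst_sum hφ, MvPowerSeries.subst_mul hφ.hasSubst,
    formalPartial, pderiv_subst hφ, ← hXY _, Finset.mul_sum, Finset.sum_mul]
  rw [Finset.sum_comm]
  exact Finset.sum_congr rfl fun l _ => Finset.sum_congr rfl fun j _ => by ring

theorem pderiv_comm (i j : Fin m) (f : FSeries m K) :
    MvPowerSeries.pderiv K i (MvPowerSeries.pderiv K j f) =
      MvPowerSeries.pderiv K j (MvPowerSeries.pderiv K i f) := by
  rcases eq_or_ne i j with rfl | hij
  · rfl
  ext n
  simp only [MvPowerSeries.coeff_pderiv, Finsupp.add_apply, Finsupp.single_eq_of_ne hij,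
    Finsupp.single_eq_of_ne hij.symm, add_zero]
  rw [add_right_comm]
  ring

/-- The Jacobian of a change of coordinates evolves by the linearized flows. -/
theorem derivation_formalJacobian {φ : Fin m → FSeries m K} (hφ : FixesOrigin φ)
    {X Y : VField m (FSeries m K)} (hXY : FormalPushforwardEq φ X Y) :
    (formalJacobian φ).map X.derivation + formalJacobian φ * formalJacobian X =
      (formalJacobian Y).map (MvPowerSeries.subst φ) * formalJacobian φ := by
  ext1 i j
  -- The identity is the `j`-th derivative of `dφ(X) = Y ∘ φ`; the second derivatives of `φ` form
  -- `X` applied to the Jacobian, by symmetry.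
  have h1 : formalPartial j (∑ l, formalPartial l (φ i) * X l) =
      formalPartial j (MvPowerSeries.subst φ (Y i)) := congrArg _ (hXY i)
  simp only [formalPartial, pderiv_subst hφ, map_sum, Derivation.leibniz, smul_eq_mul,
    Finset.sum_add_distrib] at h1
  simp only [formalJacobian, Matrix.add_apply, Matrix.map_apply, Matrix.mul_apply,
    Matrix.of_apply, VField.derivation_apply, formalPartial]
  rw [← h1, add_comm]
  congr 1
  exact Finset.sum_congr rfl fun l _ => by rw [pderiv_comm]

/-- By `slotDeriv_slotAction` it suffices to treat each slot alone. For covariant slots the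
condition is the transpose of `derivation_formalJacobian`; for contravariant slots it follows from
the same equation together with the derivative of `J⁻¹ J = 1`. -/
theorem lieDerivCoord_formalPullback {φ : Fin m → FSeries m K} (hφ : IsFormalDiffeo φ)
    {X Y : VField m (FSeries m K)} (hXY : FormalPushforwardEq φ X Y)
    (G : TField m k h (FSeries m K)) :
    lieDerivCoord formalPartial X (formalPullback φ G) =
      formalPullback φ (lieDerivCoord formalPartial Y G) := by
  apply TField.flat_injective
  let g : FSeries m K →+* FSeries m K := (MvPowerSeries.substAlgHom (R := K) hφ.1.hasSubst)
  have hg : ∀ f, MvPowerSeries.subst φ f = g f := fun f =>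
    (MvPowerSeries.substAlgHom_apply hφ.1.hasSubst f).symm
  have hg' : (MvPowerSeries.subst φ : FSeries m K → FSeries m K) = g := funext hg
  have hX : (fun f => ∑ l, X l * formalPartial l f) = X.derivation :=
    funext fun f => (X.derivation_apply f).symm
  have hY : (fun f => ∑ l, Y l * formalPartial l f) = Y.derivation :=
    funext fun f => (Y.derivation_apply f).symm
  rw [lieDerivCoord_flat, formalPullback_flat, formalPullback_flat, lieDerivCoord_flat, hX, hY]
  simp only [hg]
  rw [map_slotDeriv (δ' := X.derivation) g (fun r => by
    rw [← hg, ← hg, VField.derivation_subst hφ.1 hXY])]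
  apply slotDeriv_slotAction
  have hJ := derivation_formalJacobian hφ.1 hXY
  have hu := (Matrix.isUnit_iff_isUnit_det _).1 hφ.isUnit_formalJacobian
  rw [hg'] at hJ
  set J := formalJacobian φ with hJdef
  have hN : (Matrix.of fun p l => formalPartial l (X p)) = formalJacobian X := rfl
  have hN' : (Matrix.of fun p l => formalPartial p (X l)) = (formalJacobian X).transpose := rfl
  have hM : (Matrix.of fun p l => formalPartial l (Y p)) = formalJacobian Y := rfl
  have hM' : (Matrix.of fun p l => formalPartial p (Y l)) = (formalJacobian Y).transpose := rfl
  intro s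
  rcases s with s | s
  · simp only [pullbackSlots, lieSlots, Sum.elim_inl, hN, hM]
    have h1 : J⁻¹ * J = 1 := Matrix.nonsing_inv_mul J hu
    have h2 : J * J⁻¹ = 1 := Matrix.mul_nonsing_inv J hu
    have h3 : (J⁻¹).map X.derivation * J + J⁻¹ * J.map X.derivation = 0 := by
      ext1 i j
      have := congrArg (fun M => X.derivation (M i j)) h1
      simp only [Matrix.mul_apply, map_sum, Derivation.leibniz, smul_eq_mul,
        Finset.sum_add_distrib] at this
      have h0 : X.derivation ((1 : Matrix (Fin m) (Fin m) (FSeries m K)) i j) = 0 := by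
        rw [Matrix.one_apply]; split_ifs <;> simp
      rw [h0] at this
      simp only [Matrix.add_apply, Matrix.mul_apply, Matrix.map_apply, Matrix.zero_apply]
      rw [← this, add_comm]
      congr 1
      exact Finset.sum_congr rfl fun l _ => mul_comm _ _
    have h4 : (-formalJacobian Y).map g = -(formalJacobian Y).map g := by
      ext1 i j; simp
    have h5 : (J⁻¹).map X.derivation = -(J⁻¹ * J.map X.derivation) * J⁻¹ := by
      rw [← eq_neg_of_add_eq_zero_left h3, Matrix.mul_assoc, h2, Matrix.mul_one]
    rw [h4, h5, eq_sub_of_add_eq hJ]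
    rw [Matrix.mul_sub, ← Matrix.mul_assoc J⁻¹ J, h1, Matrix.one_mul, neg_sub, Matrix.sub_mul,
      Matrix.neg_mul, Matrix.mul_neg, Matrix.mul_assoc J⁻¹, Matrix.mul_assoc _ J, h2,
      Matrix.mul_one]
    abel
  · simp only [pullbackSlots, lieSlots, Sum.elim_inr, hN', hM']
    rw [Matrix.transpose_map, Matrix.transpose_map, ← Matrix.transpose_mul,
      ← Matrix.transpose_mul, ← Matrix.transpose_add, hJ]

end Naturality

/-! ### Generalized eigenvectors of derivations -/

section GeneralizedEigenvectors

variable {K R : Type*} [CommRing K] [CommRing R] [Algebra K R]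

/-- Products of generalized eigenvectors of a derivation, modulo an invariant ideal. -/
theorem derivation_sub_pow_mul_mem (D : Derivation K R R) {I : Ideal R}
    (hI : ∀ f ∈ I, D f ∈ I) (a b : K) {n p r : ℕ} (hn : p + r ≤ n) {f g : R}
    (hf : (((D : R →ₗ[K] R) - algebraMap K (Module.End K R) a) ^ p) f ∈ I)
    (hg : (((D : R →ₗ[K] R) - algebraMap K (Module.End K R) b) ^ r) g ∈ I) :
    (((D : R →ₗ[K] R) - algebraMap K (Module.End K R) (a + b)) ^ n) (f * g) ∈ I := by
  have hT : ∀ c : K, ∀ f ∈ I, ((D : R →ₗ[K] R) - algebraMap K (Module.End K R) c) f ∈ I := by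
    intro c f hf
    rw [LinearMap.sub_apply, Module.algebraMap_end_apply, Algebra.smul_def]
    exact sub_mem (hI f hf) (Ideal.mul_mem_left _ _ hf)
  have hTn : ∀ (c : K) (n : ℕ), ∀ f ∈ I,
      (((D : R →ₗ[K] R) - algebraMap K (Module.End K R) c) ^ n) f ∈ I := by
    intro c n
    induction n with
    | zero => exact fun f hf => hf
    | succ n ih => exact fun f hf => by rw [pow_succ, Module.End.mul_apply]; exact ih _ (hT c f hf)
  induction n generalizing p r f g with
  | zero =>
    obtain rfl : p = 0 := by omega
    exact Ideal.mul_mem_right g I hf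
  | succ n ih =>
    cases p with
    | zero => exact hTn _ _ _ (Ideal.mul_mem_right g I hf)
    | succ p =>
      cases r with
      | zero => exact hTn _ _ _ (Ideal.mul_mem_left I f hg)
      | succ r =>
        -- Leibniz: each of the two terms lowers one of the exponents `p`, `r` by one. Once an
        -- exponent reaches zero, that factor lies in the ideal `I`, which is stable under all
        -- shifts of `D`.
        have h1 : ((D : R →ₗ[K] R) - algebraMap K (Module.End K R) (a + b)) (f * g) =
            ((D : R →ₗ[K] R) - algebraMap K (Module.End K R) a) f * g +
            f * ((D : R →ₗ[K] R) - algebraMap K (Module.End K R) b) g := by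
          simp only [LinearMap.sub_apply, Module.algebraMap_end_apply, Derivation.coeFn_coe,
            Derivation.leibniz, smul_eq_mul, Algebra.smul_def]
          rw [map_add (algebraMap K R)]
          ring
        rw [pow_succ, Module.End.mul_apply, h1, map_add]
        refine add_mem (ih (p := p) (r := r + 1) (by omega) ?_ hg)
          (ih (p := p + 1) (r := r) (by omega) hf ?_)
        · rwa [pow_succ, Module.End.mul_apply] at hf
        · rwa [pow_succ, Module.End.mul_apply] at hg

theorem pow_apply_eq_zero_of_le {M : Type*} [AddCommGroup M] [Module K M] (T : Module.End K M)
    {p n : ℕ} (hn : p ≤ n) {x : M} (h : (T ^ p) x = 0) : (T ^ n) x = 0 := by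
  obtain ⟨r, rfl⟩ := Nat.exists_eq_add_of_le' hn
  rw [pow_add, Module.End.mul_apply, h, map_zero]

/-- Binomial expansion of the power `p + r`: every term contains at least `p` factors `T`, which
kill `x`, or at least `r` factors `U`. Only `T` need be nilpotent merely at the vector `x`. -/
theorem exists_add_pow_apply_eq_zero {M : Type*} [AddCommGroup M] [Module K M]
    {T U : Module.End K M} (hTU : Commute T U) (hU : IsNilpotent U) {x : M} {p : ℕ}
    (h : (T ^ p) x = 0) : ∃ n, ((T + U) ^ n) x = 0 := by
  obtain ⟨r, hr⟩ := hU
  refine ⟨p + r, ?_⟩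
  rw [hTU.add_pow, LinearMap.sum_apply]
  refine Finset.sum_eq_zero fun i _ => ?_
  rw [(hTU.pow_pow _ _).eq]
  by_cases hi : p ≤ i
  · rw [(Nat.cast_commute _ _).eq.symm, Module.End.mul_apply, Module.End.mul_apply,
      pow_apply_eq_zero_of_le T hi h, map_zero, map_zero]
  · have : U ^ (p + r - i) = 0 := pow_eq_zero_of_le (by omega) hr
    rw [this]; simp

end GeneralizedEigenvectors

/-! ### Operators on tensors -/

section SlotOperators

variable {ι σ K R : Type*} [DecidableEq ι] [Fintype σ] [CommRing K] [CommRing R] [Algebra K R]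

/-- `slotDeriv` as a linear endomorphism. -/
def slotDerivEnd [Fintype ι] (δ : Derivation K R R) (N : ι → Matrix σ σ R) :
    Module.End K ((ι → σ) → R) where
  toFun := slotDeriv δ N
  map_add' G H := by
    funext c
    simp only [slotDeriv, Pi.add_apply, map_add, mul_add, Finset.sum_add_distrib]
    abel
  map_smul' a G := by
    funext c
    simp only [slotDeriv, Pi.smul_apply, Derivation.map_smul, mul_smul_comm, ← Finset.smul_sum,
      smul_add, RingHom.id_apply]

theorem slotDerivEnd_add [Fintype ι] (δ δ' : Derivation K R R) (N N' : ι → Matrix σ σ R) :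
    slotDerivEnd (δ + δ') (N + N') = slotDerivEnd δ N + slotDerivEnd δ' N' := by
  ext G c
  simp only [slotDerivEnd, slotDeriv, LinearMap.coe_mk, AddHom.coe_mk, LinearMap.add_apply,
    Pi.add_apply, Derivation.add_apply, Matrix.add_apply, add_mul, Finset.sum_add_distrib]
  abel

/-- The action of a matrix on the slot `s`. -/
def slotEnd (s : ι) (A : Matrix σ σ R) : Module.End K ((ι → σ) → R) where
  toFun G := fun c => ∑ l, A (c s) l * G (Function.update c s l)
  map_add' G H := by
    funext c
    simp only [Pi.add_apply, mul_add, Finset.sum_add_distrib]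
  map_smul' a G := by
    funext c
    simp only [Pi.smul_apply, mul_smul_comm, ← Finset.smul_sum, RingHom.id_apply]

theorem slotEnd_apply (s : ι) (A : Matrix σ σ R) (G : (ι → σ) → R) (c : ι → σ) :
    slotEnd (K := K) s A G c = ∑ l, A (c s) l * G (Function.update c s l) := rfl

theorem slotEnd_mul_slotEnd (s : ι) (A B : Matrix σ σ R) :
    slotEnd (K := K) s A * slotEnd s B = slotEnd s (A * B) := by
  ext G c
  simp only [Module.End.mul_apply, slotEnd_apply, Function.update_self, Function.update_idem,
    Matrix.mul_apply, Finset.mul_sum, Finset.sum_mul]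
  rw [Finset.sum_comm]
  simp only [mul_assoc]

theorem slotEnd_pow_succ [DecidableEq σ] (s : ι) (A : Matrix σ σ R) (n : ℕ) :
    slotEnd (K := K) s A ^ (n + 1) = slotEnd s (A ^ (n + 1)) := by
  induction n with
  | zero => simp
  | succ n ih => rw [pow_succ, ih, slotEnd_mul_slotEnd, ← pow_succ]

theorem isNilpotent_slotEnd [DecidableEq σ] (s : ι) {A : Matrix σ σ R} (hA : IsNilpotent A) :
    IsNilpotent (slotEnd (K := K) s A) := by
  obtain ⟨p, hp⟩ := hA
  refine ⟨p + 1, ?_⟩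
  rw [slotEnd_pow_succ, pow_succ, hp, zero_mul]
  ext G c
  simp [slotEnd_apply]

theorem slotEnd_commute {s t : ι} (hst : s ≠ t) (A B : Matrix σ σ R) :
    Commute (slotEnd (K := K) s A) (slotEnd t B) := by
  ext G c
  simp only [Module.End.mul_apply, slotEnd_apply, Finset.mul_sum,
    Function.update_of_ne hst, Function.update_of_ne hst.symm]
  rw [Finset.sum_comm]
  refine Finset.sum_congr rfl fun k _ => Finset.sum_congr rfl fun l _ => ?_
  rw [Function.update_comm hst]
  ring

theorem slotDerivEnd_zero_apply [Fintype ι] (δ : Derivation K R R) (G : (ι → σ) → R)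
    (c : ι → σ) : slotDerivEnd (ι := ι) (σ := σ) δ 0 G c = δ (G c) := by
  simp [slotDerivEnd, slotDeriv]

theorem slotDerivEnd_eq [Fintype ι] (δ : Derivation K R R) (N : ι → Matrix σ σ R) :
    slotDerivEnd δ N = slotDerivEnd δ 0 + ∑ s, slotEnd s (N s) := by
  ext G c
  simp [slotDerivEnd, slotDeriv, slotEnd_apply]

theorem slotDerivEnd_zero_commute [Fintype ι] {δ : Derivation K R R} {A : Matrix σ σ R}
    (h : ∀ p l, δ (A p l) = 0) (s : ι) :
    Commute (slotDerivEnd (ι := ι) (σ := σ) δ 0) (slotEnd s A) := by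
  ext G c
  simp only [Module.End.mul_apply, slotEnd_apply, slotDerivEnd_zero_apply, map_sum,
    Derivation.leibniz, h, mul_zero, add_zero, smul_eq_mul]

/-- A locally nilpotent derivation and nilpotent constant matrices on the slots. -/
theorem exists_slotDerivEnd_pow_apply_eq_zero [Fintype ι] [DecidableEq σ] {δ : Derivation K R R}
    {N : ι → Matrix σ σ R} (hN : ∀ s, IsNilpotent (N s)) (hδ : ∀ s p l, δ (N s p l) = 0)
    {G : (ι → σ) → R} (hG : ∀ c, ∃ p, ((δ : R →ₗ[K] R) ^ p) (G c) = 0) :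
    ∃ n, (slotDerivEnd δ N ^ n) G = 0 := by
  rw [slotDerivEnd_eq]
  choose p hp using hG
  have hpow : ∀ n, ∀ c, (slotDerivEnd (ι := ι) (σ := σ) δ 0 ^ n) G c =
      ((δ : R →ₗ[K] R) ^ n) (G c) := by
    intro n
    induction n with
    | zero => exact fun c => rfl
    | succ n ih =>
      intro c
      rw [pow_succ', Module.End.mul_apply, slotDerivEnd_zero_apply, ih, pow_succ',
        Module.End.mul_apply]
      rfl
  -- `δ` acts coefficientwise and commutes with the slot matrices since it kills their entries;
  -- matrices in different slots commute, so the sum over the slots is nilpotent.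
  refine exists_add_pow_apply_eq_zero (p := Finset.univ.sup p) ?_ ?_ ?_
  · exact Commute.sum_right _ _ _ fun s _ => slotDerivEnd_zero_commute (hδ s) s
  · refine Commute.isNilpotent_sum (fun s _ => isNilpotent_slotEnd s (hN s)) fun s t _ _ => ?_
    rcases eq_or_ne s t with rfl | hst
    · exact Commute.refl _
    · exact slotEnd_commute hst _ _
  · funext c
    rw [hpow]
    exact pow_apply_eq_zero_of_le _ (Finset.le_sup (Finset.mem_univ c)) (hp c)

end SlotOperators

/-! ### Lie derivatives as operators on formal tensor fields -/

section LieOperators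

variable {m : ℕ} {K : Type*} [CommRing K]

/-- The Lie derivative along `X`, as an endomorphism. -/
noncomputable def lieEnd (X : VField m (FSeries m K)) (k h : ℕ) :
    Module.End K ((Fin k ⊕ Fin h → Fin m) → FSeries m K) :=
  slotDerivEnd X.derivation (lieSlots formalPartial X k h)

theorem lieDerivCoord_flat_eq_lieEnd {k h : ℕ} (X : VField m (FSeries m K))
    (G : TField m k h (FSeries m K)) :
    (lieDerivCoord formalPartial X G).flat = lieEnd X k h G.flat := by
  rw [lieDerivCoord_flat]
  have : (fun f => ∑ l, X l * formalPartial l f) = X.derivation :=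
    funext fun f => (X.derivation_apply f).symm
  rw [this]
  rfl

theorem derivation_add (X Y : VField m (FSeries m K)) :
    VField.derivation (X + Y) = X.derivation + Y.derivation := by
  simp only [VField.derivation, Pi.add_apply, add_smul, Finset.sum_add_distrib]

theorem lieSlots_add (X Y : VField m (FSeries m K)) (k h : ℕ) :
    lieSlots formalPartial (X + Y) k h =
      lieSlots formalPartial X k h + lieSlots formalPartial Y k h := by
  funext s
  rcases s with s | s <;> ext1 p l <;>
    simp [lieSlots, formalPartial, add_comm]

theorem lieEnd_add (X Y : VField m (FSeries m K)) (k h : ℕ) :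
    lieEnd (X + Y) k h = lieEnd X k h + lieEnd Y k h := by
  rw [lieEnd, derivation_add, lieSlots_add, slotDerivEnd_add]
  rfl

theorem derivation_mem_vanishIdeal {r q : ℕ} {X : VField m (FSeries m K)}
    (hX : ∀ i, X i ∈ vanishIdeal m K (r + 1)) {f : FSeries m K} (hf : f ∈ vanishIdeal m K q) :
    X.derivation f ∈ vanishIdeal m K (q + r) := by
  rw [VField.derivation_apply]
  refine sum_mem fun l _ => ?_
  -- The product has order `(r + 1) + (q - 1)`, with truncated subtraction; this is at least `q + r`
  -- also when `q = 0`.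
  exact vanishIdeal_anti (by omega)
    (mul_mem_vanishIdeal (hX l) (pderiv_mem_vanishIdeal_pred l hf))

theorem lieEnd_mem_vanishIdeal {r q k h : ℕ} {X : VField m (FSeries m K)}
    (hX : ∀ i, X i ∈ vanishIdeal m K (r + 1)) {G : (Fin k ⊕ Fin h → Fin m) → FSeries m K}
    (hG : ∀ c, G c ∈ vanishIdeal m K q) (c : Fin k ⊕ Fin h → Fin m) :
    lieEnd X k h G c ∈ vanishIdeal m K (q + r) := by
  refine add_mem (derivation_mem_vanishIdeal hX (hG c)) (sum_mem fun s _ => sum_mem fun l _ => ?_)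
  rw [add_comm q]
  refine mul_mem_vanishIdeal ?_ (hG _)
  rcases s with s | s
  · exact neg_mem (pderiv_mem_vanishIdeal l (hX _))
  · exact pderiv_mem_vanishIdeal _ (hX l)

/-- The linear vector field with matrix `A`. -/
noncomputable def linearField (A : Matrix (Fin m) (Fin m) K) : VField m (FSeries m K) :=
  fun i => ∑ j, MvPowerSeries.C (A i j) * MvPowerSeries.X j

theorem sub_linearField_mem {X : VField m (FSeries m K)} (hX : FixesOrigin X) (i : Fin m) :
    (X - linearField (linearPart X)) i ∈ vanishIdeal m K 2 :=
  sub_linear_mem_vanishIdeal (hX i)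

theorem fixesOrigin_linearField (A : Matrix (Fin m) (Fin m) K) :
    FixesOrigin (linearField A) := fun i => by simp [linearField]

theorem derivation_C (D : Derivation K (FSeries m K) (FSeries m K)) (c : K) :
    D (MvPowerSeries.C c) = 0 := D.map_algebraMap c

theorem formalPartial_linearField (A : Matrix (Fin m) (Fin m) K) (i l : Fin m) :
    formalPartial l (linearField A i) = MvPowerSeries.C (A i l) := by
  simp [linearField, formalPartial, MvPowerSeries.pderiv_X, Pi.single_apply]

theorem derivation_linearField_pow_X (A : Matrix (Fin m) (Fin m) K) (n : ℕ) (i : Fin m) :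
    (((linearField A).derivation : FSeries m K →ₗ[K] FSeries m K) ^ n) (MvPowerSeries.X i) =
      ∑ j, MvPowerSeries.C ((A ^ n) i j) * MvPowerSeries.X j := by
  induction n with
  | zero => simp [Matrix.one_apply]
  | succ n ih =>
    rw [pow_succ', Module.End.mul_apply, ih, map_sum]
    have : ∀ j, ((linearField A).derivation : FSeries m K →ₗ[K] FSeries m K)
        (MvPowerSeries.C ((A ^ n) i j) * MvPowerSeries.X j) =
        ∑ l, MvPowerSeries.C ((A ^ n) i j * A j l) * MvPowerSeries.X l := by
      intro j
      rw [Derivation.coeFn_coe, Derivation.leibniz, derivation_C, smul_zero, add_zero,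
        VField.derivation_X, linearField, smul_eq_mul, Finset.mul_sum]
      simp only [map_mul, mul_assoc]
    simp only [this]
    rw [Finset.sum_comm]
    simp only [← Finset.sum_mul, ← map_sum, pow_succ, Matrix.mul_apply]

/-- The exponent depends on the polynomial, so nilpotence is only local; passing to series requires
truncation. On coordinates the derivation acts through the powers of `A`, and the Leibniz rule
handles products. -/
theorem exists_derivation_linearField_pow_eq_zero {A : Matrix (Fin m) (Fin m) K}
    (hA : IsNilpotent A) (p : MvPolynomial (Fin m) K) :
    ∃ n, (((linearField A).derivation : FSeries m K →ₗ[K] FSeries m K) ^ n)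
      (p : FSeries m K) = 0 := by
  induction p using MvPolynomial.induction_on with
  | C a =>
    refine ⟨1, ?_⟩
    rw [pow_one, MvPolynomial.coe_C]
    exact derivation_C _ a
  | add p q hp hq =>
    obtain ⟨r, hr⟩ := hp
    obtain ⟨s, hs⟩ := hq
    refine ⟨r + s, ?_⟩
    rw [MvPolynomial.coe_add, map_add, pow_apply_eq_zero_of_le _ (by omega) hr,
      pow_apply_eq_zero_of_le _ (by omega) hs, add_zero]
  | mul_X p j hp =>
    obtain ⟨r, hr⟩ := hp
    obtain ⟨s, hs⟩ := hA
    refine ⟨r + s, ?_⟩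
    -- With the zero ideal and both eigenvalues zero, membership in the ideal is vanishing.
    have := derivation_sub_pow_mul_mem (linearField A).derivation (I := ⊥)
      (fun f hf => by rw [Ideal.mem_bot] at hf ⊢; rw [hf, map_zero]) 0 0 (le_refl (r + s))
      (f := (p : FSeries m K)) (g := MvPowerSeries.X j) (by simpa using hr)
      (by simp [derivation_linearField_pow_X, hs])
    simpa using this

/-- Modulo order `q` the tensor field is polynomial, and there the Lie derivative is a locally
nilpotent derivation plus constant nilpotent matrices on the slots. The remainder keeps order `q`
since a linear field does not lower it. -/
theorem exists_lieEnd_linearField_pow_mem {A : Matrix (Fin m) (Fin m) K} (hA : IsNilpotent A)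
    {k h : ℕ} (q : ℕ) (G : (Fin k ⊕ Fin h → Fin m) → FSeries m K) :
    ∃ n, ∀ c, (lieEnd (linearField A) k h ^ n) G c ∈ vanishIdeal m K q := by
  have hstab : ∀ (n : ℕ) (H : (Fin k ⊕ Fin h → Fin m) → FSeries m K),
      (∀ c, H c ∈ vanishIdeal m K q) →
      ∀ c, (lieEnd (linearField A) k h ^ n) H c ∈ vanishIdeal m K q := by
    intro n H hH
    induction n with
    | zero => exact hH
    | succ n ih =>
      rw [pow_succ', Module.End.mul_apply]
      exact lieEnd_mem_vanishIdeal (r := 0)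
        (fun i => (fixesOrigin_linearField A).mem_vanishIdeal i) ih
  let P : (Fin k ⊕ Fin h → Fin m) → FSeries m K := fun c => truncPoly q (G c)
  have hAC : IsNilpotent (A.map (MvPowerSeries.C (σ := Fin m))) := by
    have := hA.map (RingHom.mapMatrix (m := Fin m) (MvPowerSeries.C (σ := Fin m) (R := K)))
    exact this
  have hslots : lieSlots formalPartial (linearField A) k h =
      Sum.elim (fun _ => -A.map (MvPowerSeries.C (σ := Fin m)))
        (fun _ => (A.map (MvPowerSeries.C (σ := Fin m))).transpose) := by
    funext s
    rcases s with s | s <;> ext1 p l <;> simp [lieSlots, formalPartial_linearField]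
  obtain ⟨n, hn⟩ : ∃ n, (lieEnd (linearField A) k h ^ n) P = 0 := by
    apply exists_slotDerivEnd_pow_apply_eq_zero
    · intro s
      rw [hslots]
      rcases s with s | s
      · exact hAC.neg
      · exact Matrix.isNilpotent_transpose_iff.2 hAC
    · intro s p l
      rw [hslots]
      rcases s with s | s
      · simp [derivation_C]
      · simp [derivation_C]
    · exact fun c => exists_derivation_linearField_pow_eq_zero hA _
  refine ⟨n, fun c => ?_⟩
  have := hstab n (G - P) (fun c => sub_truncPoly_mem q (G c)) c
  rwa [map_sub, hn, sub_zero] at this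

/-- The Lie derivative along a vector field with nilpotent linear part is topologically
nilpotent. -/
theorem exists_lieEnd_pow_mem {Z : VField m (FSeries m K)} (hZ : FixesOrigin Z)
    (hA : IsNilpotent (linearPart Z)) {k h : ℕ} (q : ℕ)
    (G : (Fin k ⊕ Fin h → Fin m) → FSeries m K) :
    ∃ n, ∀ c, (lieEnd Z k h ^ n) G c ∈ vanishIdeal m K q := by
  set A := linearPart Z
  have hZA : lieEnd Z k h = lieEnd (linearField A) k h + lieEnd (Z - linearField A) k h := by
    rw [← lieEnd_add]; congr 1; abel
  induction q with
  | zero => exact ⟨0, fun c => mem_vanishIdeal_zero _⟩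
  | succ q ih =>
    obtain ⟨n, hn⟩ := ih
    obtain ⟨r, hr⟩ := exists_lieEnd_linearField_pow_mem hA (q + 1) ((lieEnd Z k h ^ n) G)
    set H := (lieEnd Z k h ^ n) G
    -- On tensor fields of order `q` only the linear part of `Z` matters modulo order `q + 1`, as
    -- the rest of `Z` vanishes to order two and raises the order by one.
    have hdiff : ∀ r, (∀ c, (lieEnd Z k h ^ r) H c ∈ vanishIdeal m K q) ∧
        ∀ c, (lieEnd Z k h ^ r) H c - (lieEnd (linearField A) k h ^ r) H c ∈
          vanishIdeal m K (q + 1) := by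
      intro r
      induction r with
      | zero => exact ⟨hn, fun c => by simp⟩
      | succ r ih =>
        obtain ⟨h1, h2⟩ := ih
        refine ⟨fun c => ?_, fun c => ?_⟩
        · rw [pow_succ', Module.End.mul_apply]
          exact lieEnd_mem_vanishIdeal (r := 0) (fun i => hZ.mem_vanishIdeal i) h1 c
        · have h3 := lieEnd_mem_vanishIdeal (r := 0)
            (fun i => (fixesOrigin_linearField A).mem_vanishIdeal i)
            (G := (lieEnd Z k h ^ r) H - (lieEnd (linearField A) k h ^ r) H) h2 c
          have h4 := lieEnd_mem_vanishIdeal (r := 1) (sub_linearField_mem hZ) h1 c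
          have := add_mem h3 h4
          convert this using 1
          rw [pow_succ', Module.End.mul_apply, pow_succ', Module.End.mul_apply, map_sub,
            Pi.sub_apply]
          nth_rewrite 1 [hZA]
          rw [LinearMap.add_apply, Pi.add_apply]
          abel
    refine ⟨r + n, fun c => ?_⟩
    rw [pow_add, Module.End.mul_apply]
    have := add_mem ((hdiff r).2 c) (hr c)
    rwa [sub_add_cancel] at this

end LieOperators

/-! ### Tensor fields preserved by a vector field in normal form are resonant -/

section Resonance

variable {m : ℕ} {K : Type*} [Field K]

/-- The weight of the basis vector `∂/∂x_j`, resp. `dx_j`, in a given slot under the diagonal field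
`∑ γ_j x_j ∂/∂x_j`. -/
def slotWeight {R : Type*} [Neg R] (γ : Fin m → R) (k h : ℕ) : Fin k ⊕ Fin h → Fin m → R :=
  Sum.elim (fun _ j => -γ j) (fun _ j => γ j)

theorem coeff_derivation_diagField (γ : Fin m → K) (f : FSeries m K) (n : Fin m →₀ ℕ) :
    MvPowerSeries.coeff n ((diagField γ).derivation f) =
      (∑ j, γ j * n j) * MvPowerSeries.coeff n f := by
  rw [VField.derivation_apply, map_sum, Finset.sum_mul]
  refine Finset.sum_congr rfl fun j _ => ?_
  rw [diagField, mul_assoc, MvPowerSeries.coeff_C_mul, formalPartial, mul_assoc]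
  congr 1
  rw [mul_comm, MvPowerSeries.X_def, MvPowerSeries.coeff_mul_monomial]
  split_ifs with hj
  · rw [MvPowerSeries.coeff_pderiv, tsub_add_cancel_of_le hj]
    have : 1 ≤ n j := by simpa using hj j
    simp only [Finsupp.coe_tsub, Pi.sub_apply, Finsupp.single_eq_same, Nat.cast_sub this]
    push_cast
    ring
  · have : n j = 0 := by
      by_contra h
      exact hj (Finsupp.single_le_iff.2 (Nat.one_le_iff_ne_zero.2 h))
    rw [this]; simp

/-- The derivative in `x_l` removes one factor `x_l`, hence lowers the weight by `γ l`. -/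
theorem pderiv_derivation_diagField (γ : Fin m → K) (l : Fin m) (f : FSeries m K) :
    (diagField γ).derivation (formalPartial l f) =
      formalPartial l ((diagField γ).derivation f) - γ l • formalPartial l f := by
  rw [eq_sub_iff_add_eq]
  ext n
  simp only [map_add, coeff_derivation_diagField, formalPartial, MvPowerSeries.coeff_pderiv,
    MvPowerSeries.coeff_smul, Finsupp.add_apply]
  have : ∑ j, γ j * ((n j + Finsupp.single l 1 j : ℕ) : K) = ∑ j, γ j * (n j : K) + γ l := by
    simp [mul_add, Finset.sum_add_distrib, Finsupp.single_apply]
  rw [this]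
  ring

/-- This is resonance: the `i`-th component of `Y` contains only monomials of weight `γ i`. -/
theorem derivation_diagField_of_bracket_eq_zero {Y : VField m (FSeries m K)} {γ : Fin m → K}
    (h : lieBracketCoord formalPartial Y (diagField γ) = 0) (i : Fin m) :
    (diagField γ).derivation (Y i) = γ i • Y i := by
  have h1 := congrFun h i
  simp only [lieBracketCoord, Finset.sum_sub_distrib, ← VField.derivation_apply,
    Pi.zero_apply] at h1
  rw [← sub_eq_zero.1 h1, diagField, ← MvPowerSeries.smul_eq_C_mul, Derivation.map_smul,
    VField.derivation_X]

theorem derivation_diagField_comm {Y : VField m (FSeries m K)} {γ : Fin m → K}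
    (h : lieBracketCoord formalPartial Y (diagField γ) = 0) (f : FSeries m K) :
    (diagField γ).derivation (Y.derivation f) = Y.derivation ((diagField γ).derivation f) := by
  rw [Y.derivation_apply, Y.derivation_apply, map_sum]
  refine Finset.sum_congr rfl fun l _ => ?_
  rw [Derivation.leibniz, derivation_diagField_of_bracket_eq_zero h, pderiv_derivation_diagField]
  simp only [smul_eq_mul, MvPowerSeries.smul_eq_C_mul]
  ring

/-- The weight of a matrix entry equals the change of weight caused by replacing the index `p` by
`l` in the slot, so the operator as a whole preserves weights. -/
theorem derivation_diagField_lieSlots {Y : VField m (FSeries m K)} {γ : Fin m → K}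
    (hb : lieBracketCoord formalPartial Y (diagField γ) = 0) {k h : ℕ} (s : Fin k ⊕ Fin h)
    (p l : Fin m) :
    (diagField γ).derivation (lieSlots formalPartial Y k h s p l) =
      (slotWeight γ k h s l - slotWeight γ k h s p) • lieSlots formalPartial Y k h s p l := by
  have key : ∀ p l : Fin m, (diagField γ).derivation (formalPartial l (Y p)) =
      (γ p - γ l) • formalPartial l (Y p) := by
    intro p l
    rw [pderiv_derivation_diagField, derivation_diagField_of_bracket_eq_zero hb, sub_smul]
    congr 1
    exact (MvPowerSeries.pderiv K l).map_smul _ _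
  rcases s with s | s
  · simp only [lieSlots, slotWeight, Sum.elim_inl, Matrix.neg_apply, Matrix.of_apply, map_neg, key,
      smul_neg]
    rw [neg_sub_neg]
  · simp only [lieSlots, slotWeight, Sum.elim_inr, Matrix.of_apply, key]

/-- The diagonal operator which multiplies every term of a tensor field by its weight. -/
noncomputable def weightEnd (γ : Fin m → K) (k h : ℕ) :
    Module.End K ((Fin k ⊕ Fin h → Fin m) → FSeries m K) where
  toFun G := fun c => (diagField γ).derivation (G c) + (∑ s, slotWeight γ k h s (c s)) • G c
  map_add' G H := by
    funext c
    simp only [Pi.add_apply, map_add, smul_add]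
    abel
  map_smul' a G := by
    funext c
    simp only [Pi.smul_apply, Derivation.map_smul, smul_add, RingHom.id_apply]
    rw [smul_comm]

theorem weightEnd_apply (γ : Fin m → K) (k h : ℕ) (G : (Fin k ⊕ Fin h → Fin m) → FSeries m K)
    (c : Fin k ⊕ Fin h → Fin m) : weightEnd γ k h G c =
      (diagField γ).derivation (G c) + (∑ s, slotWeight γ k h s (c s)) • G c := rfl

theorem coeff_weightEnd_pow (γ : Fin m → K) (k h : ℕ) (p : ℕ)
    (G : (Fin k ⊕ Fin h → Fin m) → FSeries m K) (c : Fin k ⊕ Fin h → Fin m) (n : Fin m →₀ ℕ) :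
    MvPowerSeries.coeff n ((weightEnd γ k h ^ p) G c) =
      (∑ j, γ j * n j + ∑ s, slotWeight γ k h s (c s)) ^ p * MvPowerSeries.coeff n (G c) := by
  induction p with
  | zero => simp
  | succ p ih =>
    rw [pow_succ', Module.End.mul_apply, weightEnd_apply, map_add, coeff_derivation_diagField,
      MvPowerSeries.coeff_smul, ih]
    ring

theorem lieEnd_diagField (γ : Fin m → K) (k h : ℕ) :
    lieEnd (diagField γ) k h = weightEnd γ k h := by
  have hs : lieSlots formalPartial (diagField γ) k h =
      fun s => Matrix.diagonal fun j => MvPowerSeries.C (slotWeight γ k h s j) := by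
    have h1 : ∀ p l : Fin m, formalPartial l (diagField γ p) =
        if p = l then MvPowerSeries.C (γ p) else 0 := by
      intro p l
      simp [formalPartial, diagField, MvPowerSeries.pderiv_X, Pi.single_apply]
    funext s
    rcases s with s | s <;> ext1 p l
    · simp only [lieSlots, slotWeight, Sum.elim_inl, Matrix.neg_apply, Matrix.of_apply, h1,
        Matrix.diagonal_apply]
      split_ifs <;> simp
    · simp only [lieSlots, slotWeight, Sum.elim_inr, Matrix.of_apply, h1, Matrix.diagonal_apply]
      by_cases hpl : p = l
      · subst hpl; simp
      · rw [if_neg hpl, if_neg (Ne.symm hpl)]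
  refine LinearMap.ext fun G => funext fun c => ?_
  rw [lieEnd, hs, weightEnd_apply]
  change slotDeriv _ _ _ _ = _
  simp only [slotDeriv, Matrix.diagonal_apply, ite_mul, zero_mul, Finset.sum_ite_eq,
    Finset.mem_univ, if_true, Function.update_eq_self, Finset.sum_smul,
    MvPowerSeries.smul_eq_C_mul]

/-- The operator form of `[L_{Y^s}, L_Y] = L_{[Y^s, Y]} = 0`, verified on coefficients: the weights
of the slot matrices compensate the change of the slot weights. -/
theorem weightEnd_commute_lieEnd {Y : VField m (FSeries m K)} {γ : Fin m → K}
    (hb : lieBracketCoord formalPartial Y (diagField γ) = 0) (k h : ℕ) :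
    Commute (weightEnd γ k h) (lieEnd Y k h) := by
  refine LinearMap.ext fun G => funext fun c => ?_
  have hω : ∀ s l, ∑ r, slotWeight γ k h r (Function.update c s l r) =
      ∑ r, slotWeight γ k h r (c r) + (slotWeight γ k h s l - slotWeight γ k h s (c s)) := by
    intro s l
    rw [← Finset.add_sum_erase _ _ (Finset.mem_univ s),
      ← Finset.add_sum_erase _ (fun r => slotWeight γ k h r (c r)) (Finset.mem_univ s),
      Function.update_self, Finset.sum_congr rfl fun r hr => by
        rw [Function.update_of_ne (Finset.ne_of_mem_erase hr)]]
    ring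
  have hL : ∀ H : (Fin k ⊕ Fin h → Fin m) → FSeries m K, lieEnd Y k h H c =
      Y.derivation (H c) +
        ∑ s, ∑ l, lieSlots formalPartial Y k h s (c s) l * H (Function.update c s l) :=
    fun H => rfl
  rw [Module.End.mul_apply, Module.End.mul_apply, weightEnd_apply, hL, hL]
  simp only [weightEnd_apply, map_add, map_sum, Derivation.leibniz, hω,
    derivation_diagField_comm hb, derivation_diagField_lieSlots hb, Derivation.map_smul]
  rw [smul_add, Finset.smul_sum, add_add_add_comm, ← Finset.sum_add_distrib]
  congr 1
  refine Finset.sum_congr rfl fun s _ => ?_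
  rw [Finset.smul_sum, ← Finset.sum_add_distrib]
  refine Finset.sum_congr rfl fun l _ => ?_
  simp only [smul_eq_mul, MvPowerSeries.smul_eq_C_mul, map_add, map_sub]
  ring

theorem fixesOrigin_diagField (γ : Fin m → K) : FixesOrigin (diagField γ) :=
  fun j => by simp [diagField]

theorem linearPart_diagField (γ : Fin m → K) :
    linearPart (diagField γ) = Matrix.diagonal γ := by
  classical
  ext1 i j
  simp only [linearPart, diagField, Matrix.of_apply, MvPowerSeries.coeff_C_mul,
    MvPowerSeries.coeff_X, Matrix.diagonal_apply, Finsupp.single_left_inj one_ne_zero, mul_ite,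
    mul_one, mul_zero]
  simp only [eq_comm]

theorem linearPart_sub {R : Type*} [CommRing R] (X Y : VField m (FSeries m R)) :
    linearPart (X - Y) = linearPart X - linearPart Y := by
  ext1 i j; simp [linearPart]

/-- The coefficients of a tensor field preserved by a vector field `Y` in normal form vanish unless
their weight under the semisimple part of `Y` is zero. -/
theorem coeff_eq_zero_of_lieEnd_eq_zero {Y : VField m (FSeries m K)} {γ : Fin m → K}
    (hY : FixesOrigin Y) (hnil : IsNilpotent (linearPart Y - Matrix.diagonal γ))
    (hb : lieBracketCoord formalPartial Y (diagField γ) = 0) {k h : ℕ}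
    {G : (Fin k ⊕ Fin h → Fin m) → FSeries m K} (hG : lieEnd Y k h G = 0)
    {c : Fin k ⊕ Fin h → Fin m} {n : Fin m →₀ ℕ}
    (hw : ∑ j, γ j * n j + ∑ s, slotWeight γ k h s (c s) ≠ 0) :
    MvPowerSeries.coeff n (G c) = 0 := by
  set Z := Y - diagField γ with hZdef
  have hZ : FixesOrigin Z := fun i => by
    rw [hZdef, Pi.sub_apply, map_sub, hY, fixesOrigin_diagField, sub_zero]
  have hZl : IsNilpotent (linearPart Z) := by
    rw [hZdef, linearPart_sub, linearPart_diagField]; exact hnil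
  set W := weightEnd γ k h
  have hYZ : lieEnd Y k h = W + lieEnd Z k h := by
    change _ = weightEnd γ k h + _
    rw [← lieEnd_diagField, ← lieEnd_add]; congr 1; rw [hZdef]; abel
  have hcomm : Commute W (lieEnd Z k h) := by
    rw [← add_sub_cancel_left W (lieEnd Z k h), ← hYZ]
    exact (weightEnd_commute_lieEnd hb k h).sub_right (Commute.refl _)
  -- From `W G = -L_Z G` and commutation. On the left a coefficient is multiplied by the `p`-th
  -- power of its weight, while for suitable `p` the right side vanishes beyond the degree of `n`.
  have hpow : ∀ p, (W ^ p) G = (-1 : K) ^ p • (lieEnd Z k h ^ p) G := by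
    intro p
    induction p with
    | zero => simp
    | succ p ih =>
      have h1 : W G = (-1 : K) • lieEnd Z k h G := by
        rw [hYZ, LinearMap.add_apply] at hG
        rw [neg_one_smul, eq_neg_iff_add_eq_zero, hG]
      rw [pow_succ', Module.End.mul_apply, ih, map_smul, ← Module.End.mul_apply,
        (hcomm.pow_right p).eq, Module.End.mul_apply, h1, map_smul, ← Module.End.mul_apply,
        ← pow_succ, smul_smul, ← pow_succ]
  obtain ⟨p, hp⟩ := exists_lieEnd_pow_mem hZ hZl (n.degree + 1) G
  have h1 := coeff_weightEnd_pow γ k h p G c n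
  have h2 : MvPowerSeries.coeff n ((W ^ p) G c) = 0 := by
    rw [hpow, Pi.smul_apply, MvPowerSeries.coeff_smul, hp c n (by omega), mul_zero]
  rw [h2] at h1
  exact (mul_eq_zero.1 h1.symm).resolve_left (pow_ne_zero p hw)

end Resonance

/-! ### The toric degree -/

section ToricDegree

variable {m d : ℕ}

theorem toricDegree_le {γ : Fin m → ℂ} {α : Fin d → ℂ} {ρ : Fin d → Fin m → ℤ}
    (h : IsIntegralDecomposition γ α ρ) : toricDegree γ ≤ d :=
  Nat.sInf_le ⟨α, ρ, h⟩

/-- The coefficients of a minimal decomposition satisfy no integral linear relation. -/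
theorem IsIntegralDecomposition.eq_zero_of_relation {γ : Fin m → ℂ} {α : Fin d → ℂ}
    {ρ : Fin d → Fin m → ℤ} (h : IsIntegralDecomposition γ α ρ) (hd : d = toricDegree γ)
    {c : Fin d → ℤ} (hc : ∑ k, α k * (c k : ℂ) = 0) (k : Fin d) : c k = 0 := by
  by_contra hk
  cases d with
  | zero => exact k.elim0
  | succ d =>
    have hk' : (c k : ℂ) ≠ 0 := by exact_mod_cast hk
    have : toricDegree γ ≤ d := by
      -- The relation is solved for `α k` and substituted, giving exponents with denominator `c k`;
      -- moving this denominator into the coefficients keeps the exponents integral and leaves `d`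
      -- terms.
      refine toricDegree_le (α := fun i => α (k.succAbove i) / c k)
        (ρ := fun i j => c k * ρ (k.succAbove i) j - c (k.succAbove i) * ρ k j) fun j => ?_
      rw [Fin.sum_univ_succAbove _ k] at hc
      rw [h j, Fin.sum_univ_succAbove _ k]
      have h1 : ∀ i, α (k.succAbove i) / c k *
          ((c k * ρ (k.succAbove i) j - c (k.succAbove i) * ρ k j : ℤ) : ℂ) =
          α (k.succAbove i) * ρ (k.succAbove i) j -
            α (k.succAbove i) * c (k.succAbove i) * (ρ k j / c k) := by
        intro i
        push_cast
        field_simp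
      simp only [h1, Finset.sum_sub_distrib, ← Finset.sum_mul]
      rw [← neg_eq_of_add_eq_zero_right hc]
      field_simp
      ring
    omega

/-- There is a minimal decomposition for which the linear torus action is effective. -/
theorem exists_effective_decomposition (γ : Fin m → ℂ) :
    ∃ (α : Fin (toricDegree γ) → ℂ) (ρ : Fin (toricDegree γ) → Fin m → ℤ),
      IsIntegralDecomposition γ α ρ ∧ ∀ t, (∀ j, torusWeight ρ t j = 1) → t = 1 := by
  -- A finitely generated subgroup of `ℂ` is free; a `ℤ`-basis gives the `α`, and the coordinates of
  -- the eigenvalues give the `ρ`.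
  let Γ : Submodule ℤ ℂ := Submodule.span ℤ (Set.range γ)
  have : Module.Finite ℤ Γ := Module.Finite.span_of_finite ℤ (Set.finite_range γ)
  have : Module.Free ℤ Γ := inferInstance
  have hγ : ∀ j, γ j ∈ Γ := fun j => Submodule.subset_span ⟨j, rfl⟩
  let b : Module.Basis (Fin (Module.finrank ℤ Γ)) ℤ Γ := Module.finBasis ℤ Γ
  have hdec : IsIntegralDecomposition γ (fun k => (b k : ℂ))
      (fun k j => b.repr ⟨γ j, hγ j⟩ k) := by
    intro j
    have := congrArg (Submodule.subtype Γ) (b.sum_repr ⟨γ j, hγ j⟩)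
    simp only [map_sum, map_smul, Submodule.subtype_apply] at this
    rw [← this]
    exact Finset.sum_congr rfl fun k _ => by rw [zsmul_eq_mul, mul_comm]
  -- Any decomposition puts `Γ` inside the `ℤ`-span of its coefficients, so it has at least as many
  -- terms as the rank of `Γ`.
  have hfin : Module.finrank ℤ Γ ≤ toricDegree γ := by
    obtain ⟨α, ρ, h⟩ : toricDegree γ ∈ {d : ℕ | ∃ (α : Fin d → ℂ) (ρ : Fin d → Fin m → ℤ),
        IsIntegralDecomposition γ α ρ} := Nat.sInf_mem ⟨_, _, _, hdec⟩
    have hb : LinearIndependent ℤ fun k => (b k : ℂ) :=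
      b.linearIndependent.map' (Submodule.subtype Γ) (Submodule.ker_subtype Γ)
    have hle : Γ ≤ Submodule.span ℤ (Set.range α) := by
      rw [Submodule.span_le]
      rintro _ ⟨j, rfl⟩
      rw [h j]
      refine sum_mem fun k _ => ?_
      rw [mul_comm, ← zsmul_eq_mul]
      exact Submodule.smul_mem _ _ (Submodule.subset_span ⟨k, rfl⟩)
    have h1 := linearIndependent_le_span_aux' _ hb (Set.range α) (by
      rintro _ ⟨k, rfl⟩
      exact hle (b k).2)
    rw [Fintype.card_fin] at h1
    exact h1.trans ((Fintype.card_range_le α).trans (by simp))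
  have hd : Module.finrank ℤ Γ = toricDegree γ := le_antisymm hfin (toricDegree_le hdec)
  rw [← hd]
  refine ⟨_, _, hdec, fun t ht => ?_⟩
  -- A torus point `t` defines a character of `Γ` whose value at `γ j` is the `j`-th torus weight.
  -- If it is trivial on these generators it is trivial on `Γ`, and at the basis vector `b k` it
  -- equals `t k`. This is where using a full basis of `Γ` yields effectiveness.
  let χ : Γ →+ Additive Circle :=
    { toFun := fun v => Additive.ofMul (∏ k, t k ^ b.repr v k)
      map_zero' := by simp
      map_add' := fun v w => by
        simp [zpow_add, Finset.prod_mul_distrib] }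
  have hχ : ∀ v : Γ, χ v = 0 := by
    rintro ⟨v, hv⟩
    induction hv using Submodule.span_induction with
    | mem x hx =>
      obtain ⟨j, rfl⟩ := hx
      exact congrArg Additive.ofMul (ht j)
    | zero => exact map_zero χ
    | add x y hx hy h1 h2 =>
      have := map_add χ ⟨x, hx⟩ ⟨y, hy⟩
      rw [h1, h2, add_zero] at this
      exact this
    | smul a x hx h1 =>
      have := map_zsmul χ a ⟨x, hx⟩
      rw [h1, smul_zero] at this
      exact this
  funext k
  have := hχ (b k)
  have h2 : χ (b k) = Additive.ofMul (t k) := by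
    change Additive.ofMul _ = _
    congr 1
    rw [Finset.prod_eq_single k]
    · simp
    · intro l _ hl
      rw [b.repr_self, Finsupp.single_eq_of_ne hl, zpow_zero]
    · simp
  rw [h2] at this
  exact this

end ToricDegree

/-! ### Associated torus actions preserve invariant tensor fields -/

section Preservation

variable {m d k h : ℕ}

theorem subst_diagField {K : Type*} [CommRing K] (w : Fin m → K) (f : FSeries m K) :
    MvPowerSeries.subst (diagField w) f = MvPowerSeries.rescale w f := by
  rw [MvPowerSeries.rescale_eq_subst]
  congr 1
  funext j
  rw [diagField, ← MvPowerSeries.smul_eq_C_mul]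
  rfl

theorem formalJacobian_diagField {K : Type*} [CommRing K] (w : Fin m → K) :
    formalJacobian (diagField w) = Matrix.diagonal fun j => MvPowerSeries.C (w j) := by
  ext1 i j
  simp only [formalJacobian, formalPartial, diagField, Matrix.of_apply, Matrix.diagonal_apply,
    Derivation.leibniz, MvPowerSeries.pderiv_C, MvPowerSeries.pderiv_X, Pi.single_apply,
    smul_eq_mul, mul_zero, add_zero, mul_ite, mul_one]

/-- The multiplicative version of `slotWeight`. -/
def slotCharacter {A : Type*} [Inv A] (w : Fin m → A) (k h : ℕ) : Fin k ⊕ Fin h → Fin m → A :=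
  Sum.elim (fun _ j => (w j)⁻¹) (fun _ j => w j)

theorem formalPullback_diagField_flat {K : Type*} [Field K] {w : Fin m → K} (hw : ∀ j, w j ≠ 0)
    (G : TField m k h (FSeries m K)) (c : Fin k ⊕ Fin h → Fin m) (n : Fin m →₀ ℕ) :
    MvPowerSeries.coeff n ((formalPullback (diagField w) G).flat c) =
      (∏ s, slotCharacter w k h s (c s)) * (∏ j, w j ^ n j) *
        MvPowerSeries.coeff n (G.flat c) := by
  have hslots : pullbackSlots (formalJacobian (diagField w)) k h =
      fun s => Matrix.diagonal fun j => MvPowerSeries.C (slotCharacter w k h s j) := by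
    rw [formalJacobian_diagField]
    funext s
    rcases s with s | s
    · simp only [pullbackSlots, slotCharacter, Sum.elim_inl]
      apply Matrix.inv_eq_left_inv
      rw [Matrix.diagonal_mul_diagonal, ← Matrix.diagonal_one]
      congr 1
      funext j
      rw [← map_mul, inv_mul_cancel₀ (hw j), map_one]
    · simp only [pullbackSlots, slotCharacter, Sum.elim_inr, Matrix.diagonal_transpose]
  rw [formalPullback_flat, hslots, slotAction_diagonal, ← map_prod, MvPowerSeries.coeff_C_mul,
    subst_diagField, MvPowerSeries.coeff_rescale, Finsupp.prod_fintype _ _ (by simp), mul_assoc]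

/-- The exponent of `t r` is the same integer that multiplies `α r` in
`sum_slotWeight_of_decomposition`; this match links the infinitesimal weight to the torus character.
-/
theorem prod_torusWeight_pow (ρ : Fin d → Fin m → ℤ) (t : Fin d → Circle)
    (c : Fin k ⊕ Fin h → Fin m) (n : Fin m →₀ ℕ) :
    (∏ s, slotCharacter (torusWeight ρ t) k h s (c s)) * ∏ j, torusWeight ρ t j ^ n j =
      ∏ r, t r ^ (∑ j, ρ r j * (n j : ℤ) + ∑ s, slotWeight (ρ r) k h s (c s)) := by
  have hz : ∀ (x : Circle) {ι : Type} (S : Finset ι) (f : ι → ℤ),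
      x ^ (∑ i ∈ S, f i) = ∏ i ∈ S, x ^ f i := fun x ι S f =>
    map_sum (zmultiplesHom (Additive Circle) (Additive.ofMul x)) f S
  have h1 : ∀ s j, slotCharacter (torusWeight ρ t) k h s j =
      ∏ r, t r ^ slotWeight (ρ r) k h s j := by
    intro s j
    rcases s with s | s
    · simp [slotCharacter, slotWeight, torusWeight]
    · simp [slotCharacter, slotWeight, torusWeight]
  simp only [h1, zpow_add, hz, Finset.prod_mul_distrib]
  rw [mul_comm, Finset.prod_comm]
  congr 1
  rw [Finset.prod_comm]
  refine Finset.prod_congr rfl fun j _ => ?_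
  simp only [torusWeight, ← Finset.prod_pow, zpow_mul, zpow_natCast]

theorem sum_slotWeight_of_decomposition {γ : Fin m → ℂ} {α : Fin d → ℂ} {ρ : Fin d → Fin m → ℤ}
    (hγ : IsIntegralDecomposition γ α ρ) (c : Fin k ⊕ Fin h → Fin m) (n : Fin m →₀ ℕ) :
    ∑ j, γ j * (n j : ℂ) + ∑ s, slotWeight γ k h s (c s) =
      ∑ r, α r * Int.cast (R := ℂ)
        (∑ j, ρ r j * (n j : ℤ) + ∑ s, slotWeight (ρ r) k h s (c s)) := by
  have h1 : ∀ s j, slotWeight γ k h s j = ∑ r, α r * ((slotWeight (ρ r) k h s j : ℤ) : ℂ) := by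
    intro s j
    rcases s with s | s
    · simp [slotWeight, hγ j]
    · simp [slotWeight, hγ j]
  simp only [h1, hγ _, Int.cast_add, Int.cast_sum, Int.cast_mul, Int.cast_natCast, mul_add,
    Finset.mul_sum, Finset.sum_mul, Finset.sum_add_distrib]
  congr 1
  · rw [Finset.sum_comm]
    simp only [mul_assoc]
  · rw [Finset.sum_comm]

theorem formalComp_diagField {K : Type*} [CommRing K] {Φ : Fin m → FSeries m K} (hΦ : FixesOrigin Φ)
    (w : Fin m → K) : formalComp (diagField w) Φ = fun j => MvPowerSeries.C (w j) * Φ j := by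
  funext j
  rw [formalComp, diagField, subst_C_mul hΦ, MvPowerSeries.subst_X hΦ.hasSubst]

theorem isFormalDiffeo_diagField {K : Type*} [Field K] {w : Fin m → K} (hw : ∀ j, w j ≠ 0) :
    IsFormalDiffeo (diagField w) := by
  apply isFormalDiffeo_of_isUnit_linearPart (fixesOrigin_diagField w)
  rw [linearPart_diagField, Matrix.isUnit_iff_isUnit_det, Matrix.det_diagonal]
  exact (Finset.prod_ne_zero_iff.2 fun j _ => hw j).isUnit

/-- In the normalizing coordinates the action is diagonal, so invariance is tested term by term:
resonance removes the terms of nonzero weight, and minimality of `d` makes the character of the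
others trivial. Conjugation by `Φ` brings the result back. -/
theorem IsAssociatedTorusAction.preserves {X : VField m (FSeries m ℂ)}
    {A : FormalTorusAction d m} (hA : IsAssociatedTorusAction X A)
    {G : TField m k h (FSeries m ℂ)} (hG : lieDerivCoord formalPartial X G = 0) :
    A.Preserves G := by
  obtain ⟨Φ, Y, γ, α, ρ, hΦ, hXY, ⟨hY, ⟨hnil, -⟩, hb⟩, hdec, hd, -, hact⟩ := hA
  obtain ⟨hΦ0, Ψ, hΨ0, hΦΨ, hΨΦ⟩ := id hΦ
  have hΨ : IsFormalDiffeo Ψ := ⟨hΨ0, Φ, hΦ0, hΨΦ, hΦΨ⟩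
  set G' := formalPullback Ψ G with hG'
  have hGG' : formalPullback Φ G' = G := by
    rw [hG', ← formalPullback_formalComp hΨ hΦ0, hΨΦ, formalPullback_formalId]
  have hYG : lieDerivCoord formalPartial Y G' = 0 := by
    have h1 := lieDerivCoord_formalPullback hΦ hXY G'
    rw [hGG', hG] at h1
    rw [← formalPullback_formalId (lieDerivCoord formalPartial Y G'), ← hΦΨ,
      formalPullback_formalComp hΦ hΨ0, ← h1, formalPullback_zero hΨ0]
  have hYG' : lieEnd Y k h G'.flat = 0 := by
    rw [← lieDerivCoord_flat_eq_lieEnd, hYG]; rfl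
  intro t
  set w : Fin m → ℂ := fun j => (torusWeight ρ t j : ℂ) with hw
  have hw0 : ∀ j, w j ≠ 0 := fun j => Circle.coe_ne_zero _
  have hinv : formalPullback (diagField w) G' = G' := by
    apply TField.flat_injective
    funext c
    ext n
    rw [formalPullback_diagField_flat hw0]
    -- At zero weight every exponent of the torus character vanishes and the factor is one; at
    -- nonzero weight the coefficient itself is zero.
    by_cases hwt : ∑ j, γ j * (n j : ℂ) + ∑ s, slotWeight γ k h s (c s) = 0
    · rw [sum_slotWeight_of_decomposition hdec] at hwt
      have h0 := hdec.eq_zero_of_relation hd hwt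
      have h1 := prod_torusWeight_pow ρ t c n
      simp only [h0, zpow_zero, Finset.prod_const_one] at h1
      have h2 := congrArg (Circle.coeHom) h1
      simp only [map_mul, map_prod, map_pow, map_one] at h2
      have h3 : ∀ s j, Circle.coeHom (slotCharacter (torusWeight ρ t) k h s j) =
          slotCharacter w k h s j := by
        intro s j
        rcases s with s | s
        · simp [slotCharacter, w]; rfl
        · simp [slotCharacter, w]; rfl
      simp only [h3] at h2
      have h4 : ∀ j, Circle.coeHom (torusWeight ρ t j) = w j := fun j => rfl
      simp only [h4] at h2
      rw [h2, one_mul]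
    · rw [coeff_eq_zero_of_lieEnd_eq_zero hY hnil hb hYG' hwt, mul_zero]
  have hA0 := A.fixesOrigin t
  -- The intertwining relation in the definition determines the action, since `Φ` can be cancelled
  -- by its inverse `Ψ`.
  have hcomp : A.act t = formalComp Ψ (formalComp (diagField w) Φ) := by
    rw [formalComp_diagField hΦ0, ← formalId_formalComp hA0, ← hΨΦ, formalComp_assoc Ψ hΦ0 hA0]
    congr 1
    funext j
    exact hact t j
  have hdw := isFormalDiffeo_diagField hw0
  rw [hcomp, formalPullback_formalComp hΨ (hdw.1.formalComp hΦ0), ← hG',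
    formalPullback_formalComp hdw hΦ0, hinv, hGG']

end Preservation

/-! ### Generalized eigenspaces -/

section LinearAlgebra

variable {K V W : Type*} [Field K] [AddCommGroup V] [Module K V] [AddCommGroup W] [Module K W]

/-- A finite-dimensional space over an algebraically closed field has a basis of generalized
eigenvectors. -/
theorem exists_linearIndependent_maxGenEigenspace [IsAlgClosed K] [FiniteDimensional K V]
    {m : ℕ} (hm : Module.finrank K V = m)
    (T : Module.End K V) :
    ∃ (v : Fin m → V) (γ : Fin m → K), LinearIndependent K v ∧
      ∀ i, v i ∈ T.maxGenEigenspace (γ i) := by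
  -- The generalized eigenvectors span, so a basis can be extracted from among them.
  let s : Set V := ⋃ μ, (T.maxGenEigenspace μ : Set V)
  have hs : Submodule.span K s = ⊤ := by
    rw [Submodule.span_iUnion]
    simp only [Submodule.span_eq]
    exact Module.End.iSup_maxGenEigenspace_eq_top T
  obtain ⟨b, hbs, hspan, hb⟩ := exists_linearIndependent K s
  let B : Module.Basis b K V := Module.Basis.mk hb (by rw [Subtype.range_coe, hspan, hs])
  have : Fintype b := FiniteDimensional.fintypeBasisIndex B
  have hcard : Fintype.card b = m := by rw [← hm, Module.finrank_eq_card_basis B]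
  let e : Fin m ≃ b := (Fintype.equivFinOfCardEq hcard).symm
  have hmem : ∀ i, ∃ μ, (e i : V) ∈ T.maxGenEigenspace μ := fun i =>
    Set.mem_iUnion.1 (hbs (e i).2)
  choose γ hγ using hmem
  exact ⟨fun i => (e i : V), γ, hb.comp e e.injective, hγ⟩

theorem map_maxGenEigenspace_le {T : Module.End K V} {S : Module.End K W} {π : V →ₗ[K] W}
    (h : ∀ x, π (T x) = S (π x)) (μ : K) :
    (T.maxGenEigenspace μ).map π ≤ S.maxGenEigenspace μ := by
  rintro _ ⟨x, hx, rfl⟩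
  rw [SetLike.mem_coe, Module.End.mem_maxGenEigenspace] at hx
  rw [Module.End.mem_maxGenEigenspace]
  obtain ⟨p, hp⟩ := hx
  refine ⟨p, ?_⟩
  have : ∀ n x, ((S - μ • (1 : Module.End K W)) ^ n) (π x) =
      π (((T - μ • (1 : Module.End K V)) ^ n) x) := by
    intro n
    induction n with
    | zero => exact fun x => rfl
    | succ n ih =>
      intro x
      rw [pow_succ, Module.End.mul_apply, pow_succ, Module.End.mul_apply, ← ih]
      congr 1
      simp [h]
  rw [this, hp, map_zero]

/-- Generalized eigenvectors lift along surjections. -/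
theorem exists_mem_maxGenEigenspace_of_surjective [IsAlgClosed K] [FiniteDimensional K V]
    {T : Module.End K V} {S : Module.End K W}
    {π : V →ₗ[K] W} (h : ∀ x, π (T x) = S (π x)) (hπ : Function.Surjective π) {μ : K} {y : W}
    (hy : y ∈ S.maxGenEigenspace μ) : ∃ x ∈ T.maxGenEigenspace μ, π x = y := by
  obtain ⟨x, rfl⟩ := hπ y
  have hx : x ∈ (⊤ : Submodule K V) := Submodule.mem_top
  -- Any preimage splits into its `μ`-component `a` and the rest `b`. The image of `b` lies in the
  -- sum of the other generalized eigenspaces and, by subtraction, in that of `μ`; so it is zero and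
  -- `a` is the lift.
  rw [← Module.End.iSup_maxGenEigenspace_eq_top T, iSup_split_single _ μ, Submodule.mem_sup] at hx
  obtain ⟨a, ha, b, hb, rfl⟩ := hx
  refine ⟨a, ha, ?_⟩
  have ha' := map_maxGenEigenspace_le h μ (Submodule.mem_map_of_mem ha)
  have hb' : π b ∈ ⨆ ν, ⨆ (_ : ν ≠ μ), S.maxGenEigenspace ν := by
    have h1 := Submodule.mem_map_of_mem (f := π) hb
    simp only [Submodule.map_iSup] at h1
    exact iSup₂_mono (fun ν _ => map_maxGenEigenspace_le h ν) h1
  have h2 : π b ∈ S.maxGenEigenspace μ := by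
    have := sub_mem hy ha'
    rwa [map_add, add_sub_cancel_left] at this
  have h3 := Submodule.disjoint_def.1
    (iSupIndep_def.1 (Module.End.independent_maxGenEigenspace S) μ) _ h2 hb'
  rw [map_add, h3, add_zero]

end LinearAlgebra

/-! ### Generalized eigenfunctions of a formal vector field -/

section Eigenfunctions

variable {m : ℕ} {K : Type*} [Field K]

/-- The operator `X - c` on formal series. -/
noncomputable def VField.shift (X : VField m (FSeries m K)) (c : K) :
    Module.End K (FSeries m K) :=
  (X.derivation : FSeries m K →ₗ[K] FSeries m K) - algebraMap K _ c

theorem VField.shift_apply (X : VField m (FSeries m K)) (c : K) (f : FSeries m K) :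
    X.shift c f = X.derivation f - c • f := rfl

/-- The series which are generalized eigenvectors of `X` to every finite order. -/
def VField.IsGenEigen (X : VField m (FSeries m K)) (c : K) (f : FSeries m K) : Prop :=
  ∀ q, ∃ p, (X.shift c ^ p) f ∈ vanishIdeal m K q

variable {X : VField m (FSeries m K)}

theorem derivation_mem_of_fixesOrigin (hX : FixesOrigin X) {q : ℕ} {f : FSeries m K}
    (hf : f ∈ vanishIdeal m K q) : X.derivation f ∈ vanishIdeal m K q :=
  derivation_mem_vanishIdeal (r := 0) (fun i => hX.mem_vanishIdeal i) hf

theorem shift_pow_mem (hX : FixesOrigin X) (c : K) (p : ℕ) {q : ℕ} {f : FSeries m K}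
    (hf : f ∈ vanishIdeal m K q) : (X.shift c ^ p) f ∈ vanishIdeal m K q := by
  induction p with
  | zero => exact hf
  | succ p ih =>
    rw [pow_succ', Module.End.mul_apply, VField.shift_apply]
    exact sub_mem (derivation_mem_of_fixesOrigin hX ih) (smul_mem_vanishIdeal c ih)

theorem VField.IsGenEigen.mul (hX : FixesOrigin X) {a b : K} {f g : FSeries m K}
    (hf : X.IsGenEigen a f) (hg : X.IsGenEigen b g) : X.IsGenEigen (a + b) (f * g) := by
  intro q
  obtain ⟨p, hp⟩ := hf q
  obtain ⟨r, hr⟩ := hg q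
  exact ⟨p + r, derivation_sub_pow_mul_mem X.derivation
    (fun f hf => derivation_mem_of_fixesOrigin hX hf) a b le_rfl hp hr⟩

theorem VField.IsGenEigen.one : X.IsGenEigen 0 1 := fun q => ⟨1, by
  rw [pow_one, VField.shift_apply, zero_smul, sub_zero, Derivation.map_one_eq_zero]
  exact zero_mem _⟩

theorem VField.IsGenEigen.derivation (hX : FixesOrigin X) {c : K} {f : FSeries m K}
    (hf : X.IsGenEigen c f) : X.IsGenEigen c (X.derivation f) := by
  intro q
  obtain ⟨p, hp⟩ := hf q
  refine ⟨p, ?_⟩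
  have hc : Commute (X.shift c) (X.derivation : FSeries m K →ₗ[K] FSeries m K) := by
    refine Commute.sub_left (Commute.refl _) ?_
    exact Algebra.commutes c _
  have := LinearMap.congr_fun (hc.pow_left p).eq f
  rw [Module.End.mul_apply, Module.End.mul_apply] at this
  exact this ▸ derivation_mem_of_fixesOrigin hX hp

theorem VField.IsGenEigen.monomial (hX : FixesOrigin X) {γ : Fin m → K}
    (hγ : ∀ j, X.IsGenEigen (γ j) (MvPowerSeries.X j)) (n : Fin m →₀ ℕ) :
    X.IsGenEigen (∑ j, γ j * n j) (MvPowerSeries.monomial n 1) := by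
  induction n using Finsupp.induction_linear with
  | zero =>
    rw [MvPowerSeries.monomial_zero_eq_C_apply, map_one]
    simpa using VField.IsGenEigen.one (X := X)
  | add a b ha hb =>
    have := ha.mul hX hb
    rw [MvPowerSeries.monomial_mul_monomial, one_mul, ← Finset.sum_add_distrib] at this
    simpa [mul_add] using this
  | single i d =>
    have hs : ∑ j, γ j * ((Finsupp.single i d j : ℕ) : K) = d * γ i := by
      simp [Finsupp.single_apply, mul_comm]
    rw [hs]
    clear hs
    induction d with
    | zero =>
      rw [Finsupp.single_zero, MvPowerSeries.monomial_zero_eq_C_apply, map_one]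
      simpa using VField.IsGenEigen.one (X := X)
    | succ d ih =>
      have := ih.mul hX (hγ i)
      rw [MvPowerSeries.X_def, MvPowerSeries.monomial_mul_monomial, one_mul,
        ← Finsupp.single_add] at this
      push_cast
      rwa [add_mul, one_mul]

/-- Series up to terms of order `q`. -/
abbrev Jet (m : ℕ) (K : Type*) [Field K] (q : ℕ) :=
  FSeries m K ⧸ (vanishIdeal m K q).restrictScalars K

theorem Jet.mk_eq_zero {q : ℕ} {f : FSeries m K} :
    (Submodule.Quotient.mk f : Jet m K q) = 0 ↔ f ∈ vanishIdeal m K q := by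
  rw [Submodule.Quotient.mk_eq_zero, Submodule.restrictScalars_mem]

theorem Jet.mk_eq_sum (q : ℕ) (f : FSeries m K) : (Submodule.Quotient.mk f : Jet m K q) =
    ∑ n ∈ lowIndices m q, MvPowerSeries.coeff n f •
      (Submodule.Quotient.mk (MvPowerSeries.monomial n (1 : K)) : Jet m K q) := by
  have h1 : (Submodule.Quotient.mk f : Jet m K q) =
      Submodule.Quotient.mk (truncPoly q f : FSeries m K) :=
    (Submodule.Quotient.eq _).2 (sub_truncPoly_mem q f)
  rw [h1, truncPoly_coe]
  change Submodule.mkQ _ _ = _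
  rw [map_sum]
  exact Finset.sum_congr rfl fun n _ => map_smul _ _ _

instance Jet.finiteDimensional (q : ℕ) : FiniteDimensional K (Jet m K q) := by
  let e : (Fin m →₀ ℕ) → Jet m K q := fun n =>
    Submodule.Quotient.mk (MvPowerSeries.monomial n (1 : K))
  have h : Submodule.span K (e '' (lowIndices m q : Set (Fin m →₀ ℕ))) = ⊤ := by
    rw [eq_top_iff]
    rintro x -
    obtain ⟨f, rfl⟩ := Submodule.Quotient.mk_surjective _ x
    rw [Jet.mk_eq_sum]
    exact sum_mem fun n hn => Submodule.smul_mem _ _ (Submodule.subset_span ⟨n, hn, rfl⟩)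
  exact Module.Finite.of_fg_top (h ▸ Submodule.fg_span ((lowIndices m q).finite_toSet.image e))

/-- The action of a vector field on jets. -/
noncomputable def Jet.act (hX : FixesOrigin X) (q : ℕ) : Module.End K (Jet m K q) :=
  Submodule.mapQ _ _ (X.derivation : FSeries m K →ₗ[K] FSeries m K)
    fun _ hf => derivation_mem_of_fixesOrigin hX hf

theorem Jet.mem_maxGenEigenspace (hX : FixesOrigin X) {q : ℕ} {c : K} {f : FSeries m K} :
    (Submodule.Quotient.mk f : Jet m K q) ∈ (Jet.act hX q).maxGenEigenspace c ↔
      ∃ p, (X.shift c ^ p) f ∈ vanishIdeal m K q := by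
  rw [Module.End.mem_maxGenEigenspace]
  refine exists_congr fun p => ?_
  rw [← Jet.mk_eq_zero]
  have : ∀ f : FSeries m K, ((Jet.act hX q - c • 1) ^ p) (Submodule.Quotient.mk f : Jet m K q) =
      Submodule.Quotient.mk ((X.shift c ^ p) f) := by
    induction p with
    | zero => exact fun f => rfl
    | succ p ih =>
      intro f
      rw [pow_succ, Module.End.mul_apply, pow_succ, Module.End.mul_apply, ← ih]
      rfl
  rw [this]

/-- If the coordinates are generalized eigenfunctions, then so are the monomials, and a generalized
eigenfunction contains only the monomials with the same eigenvalue. -/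
theorem coeff_eq_zero_of_isGenEigen (hX : FixesOrigin X) {γ : Fin m → K}
    (hγ : ∀ j, X.IsGenEigen (γ j) (MvPowerSeries.X j)) {c : K} {f : FSeries m K}
    (hf : X.IsGenEigen c f) {n : Fin m →₀ ℕ} (hn : ∑ j, γ j * n j ≠ c) :
    MvPowerSeries.coeff n f = 0 := by
  classical
  set q := n.degree + 1 with hq
  let w : (Fin m →₀ ℕ) → K := fun n => ∑ j, γ j * n j
  -- `g` is the part of `f` below degree `q` with weights different from `c`. Its jet lies in the
  -- generalized eigenspace of `c`, being the jet of `f` minus terms of weight `c`, and also in the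
  -- sum of the others; hence it is zero. Taking `q = n.degree + 1` makes the coefficient at `n`
  -- visible in the jet.
  let g : FSeries m K := ∑ k ∈ (lowIndices m q).filter (fun k => ¬ w k = c),
    MvPowerSeries.coeff k f • MvPowerSeries.monomial k (1 : K)
  let e : (Fin m →₀ ℕ) → Jet m K q := fun k =>
    Submodule.Quotient.mk (MvPowerSeries.monomial k (1 : K))
  have he : ∀ k, e k ∈ (Jet.act hX q).maxGenEigenspace (w k) := fun k =>
    (Jet.mem_maxGenEigenspace hX).2 (VField.IsGenEigen.monomial hX hγ k q)
  have hg : (Submodule.Quotient.mk g : Jet m K q) =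
      ∑ k ∈ (lowIndices m q).filter (fun k => ¬ w k = c), MvPowerSeries.coeff k f • e k := by
    change Submodule.mkQ _ _ = _
    rw [map_sum]
    exact Finset.sum_congr rfl fun n _ => map_smul _ _ _
  have h1 : (Submodule.Quotient.mk g : Jet m K q) ∈ (Jet.act hX q).maxGenEigenspace c := by
    have h2 := (Jet.mem_maxGenEigenspace hX).2 (hf q)
    rw [Jet.mk_eq_sum, ← Finset.sum_filter_add_sum_filter_not _ (fun k => w k = c)] at h2
    rw [hg]
    refine (Submodule.add_mem_iff_right _ (sum_mem fun k hk => ?_)).1 h2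
    have := (Finset.mem_filter.1 hk).2 ▸ he k
    exact Submodule.smul_mem _ _ this
  have h2 : (Submodule.Quotient.mk g : Jet m K q) ∈
      ⨆ ν, ⨆ (_ : ν ≠ c), (Jet.act hX q).maxGenEigenspace ν := by
    rw [hg]
    refine sum_mem fun k hk => Submodule.smul_mem _ _ ?_
    exact Submodule.mem_iSup_of_mem (w k)
      (Submodule.mem_iSup_of_mem (Finset.mem_filter.1 hk).2 (he k))
  have h3 := Submodule.disjoint_def.1
    (iSupIndep_def.1 (Module.End.independent_maxGenEigenspace (Jet.act hX q)) c) _ h1 h2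
  rw [Jet.mk_eq_zero] at h3
  have h4 := h3 n (by omega)
  simpa [g, MvPowerSeries.coeff_monomial, mem_lowIndices, hq, w, hn] using h4

/-- Generalized eigenfunctions modulo terms of order `q` lift. -/
theorem exists_isGenEigen_lift [IsAlgClosed K] (hX : FixesOrigin X) {q₀ : ℕ} {c : K}
    {f₀ : FSeries m K} (hf : ∃ p, (X.shift c ^ p) f₀ ∈ vanishIdeal m K q₀) :
    ∃ f, X.IsGenEigen c f ∧ f - f₀ ∈ vanishIdeal m K q₀ := by
  -- The hypothesis stands inside the existential, with default value `0` when it fails, so that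
  -- choice gives a total function to iterate.
  have hstep : ∀ q (f : FSeries m K), ∃ g, (∃ p, (X.shift c ^ p) f ∈ vanishIdeal m K q) →
      (∃ p, (X.shift c ^ p) g ∈ vanishIdeal m K (q + 1)) ∧ g - f ∈ vanishIdeal m K q := by
    intro q f
    by_cases hf : ∃ p, (X.shift c ^ p) f ∈ vanishIdeal m K q
    · let π : Jet m K (q + 1) →ₗ[K] Jet m K q := Submodule.factor fun f hf =>
        vanishIdeal_anti (Nat.le_succ q) hf
      have hπ : ∀ f : FSeries m K, π (Submodule.Quotient.mk f) = Submodule.Quotient.mk f :=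
        fun f => rfl
      have hcomm : ∀ x, π (Jet.act hX (q + 1) x) = Jet.act hX q (π x) := by
        intro x
        obtain ⟨f, rfl⟩ := Submodule.Quotient.mk_surjective _ x
        rfl
      have hsurj : Function.Surjective π := by
        intro y
        obtain ⟨f, rfl⟩ := Submodule.Quotient.mk_surjective _ y
        exact ⟨Submodule.Quotient.mk f, rfl⟩
      obtain ⟨x, hx, hxf⟩ := exists_mem_maxGenEigenspace_of_surjective hcomm hsurj
        ((Jet.mem_maxGenEigenspace hX).2 hf)
      obtain ⟨g, rfl⟩ := Submodule.Quotient.mk_surjective _ x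
      refine ⟨g, fun _ => ⟨(Jet.mem_maxGenEigenspace hX).1 hx, ?_⟩⟩
      exact (Submodule.Quotient.eq _).1 ((hπ g).symm.trans hxf)
    · exact ⟨0, fun h => absurd h hf⟩
  choose F hF using hstep
  let s : ℕ → FSeries m K := fun n => Nat.rec f₀ (fun n g => F (q₀ + n) g) n
  have hs : ∀ n, ∃ p, (X.shift c ^ p) (s n) ∈ vanishIdeal m K (q₀ + n) := by
    intro n
    induction n with
    | zero => exact hf
    | succ n ih => exact (hF (q₀ + n) (s n) ih).1
  -- The sequence starts at order `q₀`, whence the shift of the index; only `q ≥ q₀` is used, so the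
  -- subtraction is exact.
  obtain ⟨f, hlim⟩ := exists_limit_of_steps (s := fun q => s (q - q₀)) (q₀ := q₀) fun q hq => by
    have h1 : q + 1 - q₀ = (q - q₀) + 1 := by omega
    have h2 := (hF (q₀ + (q - q₀)) (s (q - q₀)) (hs _)).2
    rw [Nat.add_sub_cancel' hq] at h2
    simp only [h1]
    have h3 : s (q - q₀ + 1) = F (q₀ + (q - q₀)) (s (q - q₀)) := rfl
    rw [h3, Nat.add_sub_cancel' hq]
    exact h2
  refine ⟨f, fun q => ?_, ?_⟩
  · obtain ⟨p, hp⟩ := hs q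
    have h1 := hlim (q₀ + q) (by omega)
    rw [Nat.add_sub_cancel_left] at h1
    have h2 := add_mem (shift_pow_mem hX c p h1) hp
    rw [map_sub, sub_add_cancel] at h2
    exact ⟨p, vanishIdeal_anti (by omega) h2⟩
  · have := hlim q₀ le_rfl
    rwa [Nat.sub_self] at this

end Eigenfunctions

/-! ### Existence of Poincaré–Dulac normal forms and of associated torus actions -/

section NormalForm

variable {m : ℕ} {K : Type*} [Field K]

/-- The linear form with coefficients `v`. -/
noncomputable def linearForm (v : Fin m → K) : FSeries m K :=
  ∑ j, MvPowerSeries.C (v j) * MvPowerSeries.X j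

theorem coeff_single_linearForm (v : Fin m → K) (j : Fin m) :
    MvPowerSeries.coeff (Finsupp.single j 1) (linearForm v) = v j := by
  classical
  simp only [linearForm, map_sum, MvPowerSeries.coeff_C_mul, MvPowerSeries.coeff_X,
    Finsupp.single_left_inj one_ne_zero]
  simp

theorem linearForm_mem (v : Fin m → K) : linearForm v ∈ vanishIdeal m K 1 :=
  sum_mem fun j _ => C_mul_mem_vanishIdeal _ (X_mem_vanishIdeal j)

theorem linearForm_single (i : Fin m) :
    linearForm (Pi.single i (1 : K)) = (MvPowerSeries.X i : FSeries m K) := by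
  rw [linearForm, Finset.sum_eq_single i]
  · simp
  · intro j _ hj; simp [hj]
  · simp

theorem linearForm_sub (v w : Fin m → K) :
    linearForm (v - w) = linearForm v - linearForm w := by
  simp [linearForm, sub_mul, Finset.sum_sub_distrib]

theorem linearForm_smul (c : K) (v : Fin m → K) : linearForm (c • v) = c • linearForm v := by
  simp [linearForm, Finset.smul_sum, MvPowerSeries.smul_eq_C_mul, mul_assoc]

theorem eq_zero_of_linearForm_mem {v : Fin m → K} (h : linearForm v ∈ vanishIdeal m K 2) :
    v = 0 := by
  funext j
  rw [← coeff_single_linearForm v j, Pi.zero_apply]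
  exact h _ (by simp)

variable {X : VField m (FSeries m K)}

/-- Modulo order two a vector field acts on linear forms through its linear part. Linear forms are
row vectors, so the matrix multiplies from the right, and its left generalized eigenvectors are the
ones to lift. -/
theorem shift_linearForm_sub_mem (hX : FixesOrigin X) (c : K) (v : Fin m → K) :
    X.shift c (linearForm v) - linearForm (Matrix.vecMul v (linearPart X - c • 1)) ∈
      vanishIdeal m K 2 := by
  have h1 : X.derivation (linearForm v) = ∑ j, MvPowerSeries.C (v j) * X j := by
    rw [linearForm, map_sum]
    refine Finset.sum_congr rfl fun j _ => ?_
    rw [Derivation.leibniz, derivation_C, smul_zero, add_zero, VField.derivation_X, smul_eq_mul]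
  have h2 : linearForm (Matrix.vecMul v (linearPart X)) =
      ∑ j, MvPowerSeries.C (v j) * linearField (linearPart X) j := by
    simp only [linearForm, linearField, Matrix.vecMul, dotProduct, map_sum, map_mul,
      Finset.sum_mul, Finset.mul_sum]
    rw [Finset.sum_comm]
    simp only [mul_assoc]
  rw [VField.shift_apply, Matrix.vecMul_sub, Matrix.vecMul_smul, Matrix.vecMul_one, linearForm_sub,
    linearForm_smul, sub_sub_sub_cancel_right, h1, h2, ← Finset.sum_sub_distrib]
  refine sum_mem fun j _ => ?_
  rw [← mul_sub]
  exact C_mul_mem_vanishIdeal _ (sub_linearField_mem hX j)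

theorem shift_pow_linearForm_sub_mem (hX : FixesOrigin X) (c : K) (v : Fin m → K) (p : ℕ) :
    (X.shift c ^ p) (linearForm v) - linearForm (Matrix.vecMul v ((linearPart X - c • 1) ^ p)) ∈
      vanishIdeal m K 2 := by
  induction p with
  | zero => simp
  | succ p ih =>
    have h1 := shift_pow_mem hX c 1 ih
    have h2 := shift_linearForm_sub_mem hX c
      (Matrix.vecMul v ((linearPart X - c • 1) ^ p))
    rw [pow_one, map_sub] at h1
    have := add_mem h1 h2
    rwa [sub_add_sub_cancel, Matrix.vecMul_vecMul, ← pow_succ, ← Module.End.mul_apply,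
      ← pow_succ'] at this

theorem vecMulLinear_sub_pow_apply (A : Matrix (Fin m) (Fin m) K) (c : K) (p : ℕ)
    (v : Fin m → K) :
    (((Matrix.vecMulLinear A : Module.End K (Fin m → K)) - c • 1) ^ p) v =
      Matrix.vecMul v ((A - c • 1) ^ p) := by
  induction p with
  | zero => simp
  | succ p ih =>
    rw [pow_succ', Module.End.mul_apply, ih, pow_succ, ← Matrix.vecMul_vecMul]
    simp [Matrix.vecMul_sub, Matrix.vecMul_smul]

/-- There are formal coordinates made of generalized eigenfunctions. -/
theorem exists_eigen_coordinates [IsAlgClosed K] (hX : FixesOrigin X) :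
    ∃ (Φ : Fin m → FSeries m K) (γ : Fin m → K), IsFormalDiffeo Φ ∧
      ∀ i, X.IsGenEigen (γ i) (Φ i) := by
  obtain ⟨v, γ, hv, hγ⟩ := exists_linearIndependent_maxGenEigenspace
    (Module.finrank_fin_fun K (n := m))
    (Matrix.vecMulLinear (linearPart X) : Module.End K (Fin m → K))
  have hlift : ∀ i, ∃ f, X.IsGenEigen (γ i) f ∧ f - linearForm (v i) ∈ vanishIdeal m K 2 := by
    intro i
    refine exists_isGenEigen_lift hX ?_
    obtain ⟨p, hp⟩ := (Module.End.mem_maxGenEigenspace _ _ _).1 (hγ i)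
    refine ⟨p, ?_⟩
    rw [vecMulLinear_sub_pow_apply] at hp
    have := shift_pow_linearForm_sub_mem hX (γ i) (v i) p
    rwa [hp, ← sub_self (0 : Fin m → K), linearForm_sub, sub_self, sub_zero] at this
  choose Φ hΦ hΦv using hlift
  refine ⟨Φ, γ, isFormalDiffeo_of_isUnit_linearPart (fun i => ?_) ?_, hΦ⟩
  · rw [← mem_vanishIdeal_one]
    have := add_mem (vanishIdeal_anti one_le_two (hΦv i)) (linearForm_mem (v i))
    rwa [sub_add_cancel] at this
  -- The lifts have the basis vectors `v i` as linear parts, so linear independence gives an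
  -- invertible linear part and the formal inverse function theorem applies.
  · have : linearPart Φ = Matrix.of v := by
      ext1 i j
      have := hΦv i (Finsupp.single j 1) (by simp)
      rw [map_sub, coeff_single_linearForm, sub_eq_zero] at this
      exact this
    rw [this, ← Matrix.linearIndependent_rows_iff_isUnit]
    exact hv

/-- The `i`-th unit row is killed by `diag γ - γ i`, which commutes with `M`, so this summand drops
out of every power. -/
theorem single_vecMul_sub_smul_pow {γ : Fin m → K} {M : Matrix (Fin m) (Fin m) K}
    (h : Commute (Matrix.diagonal γ) M) (i : Fin m) (p : ℕ) :
    Matrix.vecMul (Pi.single i 1) ((M + Matrix.diagonal γ - γ i • 1) ^ p) =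
      Matrix.vecMul (Pi.single i 1) (M ^ p) := by
  set N := Matrix.diagonal γ - γ i • (1 : Matrix (Fin m) (Fin m) K) with hN
  have hc : Commute N M := h.sub_left ((Commute.one_left M).smul_left (γ i))
  have h0 : Matrix.vecMul (Pi.single i 1) N = 0 := by
    funext j
    rw [Matrix.single_one_vecMul]
    by_cases hij : i = j
    · subst hij; simp [hN]
    · simp [hN, Matrix.diagonal_apply_ne _ hij, Matrix.one_apply_ne hij]
  rw [add_sub_assoc, ← hN]
  induction p with
  | zero => rfl
  | succ p ih =>
    rw [pow_succ, ← Matrix.vecMul_vecMul, ih, Matrix.vecMul_add, Matrix.vecMul_vecMul,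
      Matrix.vecMul_vecMul, ← (hc.pow_right p).eq, ← Matrix.vecMul_vecMul _ N, h0,
      Matrix.zero_vecMul, add_zero, ← pow_succ]

/-- Every formal vector field vanishing at the origin has a Poincaré–Dulac normal form. -/
theorem exists_poincareDulac {X : VField m (FSeries m ℂ)} (hX : FixesOrigin X) :
    ∃ (Φ : Fin m → FSeries m ℂ) (Y : VField m (FSeries m ℂ)) (γ : Fin m → ℂ),
      IsFormalDiffeo Φ ∧ FormalPushforwardEq Φ X Y ∧ IsPoincareDulacNormalForm Y γ := by
  obtain ⟨Φ, γ, hΦ, hΦγ⟩ := exists_eigen_coordinates hX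
  obtain ⟨hΦ0, Ψ, hΨ0, hΦΨ, hΨΦ⟩ := id hΦ
  -- `Y` is `X` written in the coordinates `Φ`; the coordinates of the new chart are then
  -- generalized eigenfunctions of `Y`.
  let Y : VField m (FSeries m ℂ) := fun i => MvPowerSeries.subst Ψ (X.derivation (Φ i))
  have hY0 : FixesOrigin Y := fun i => mem_vanishIdeal_one.1 (subst_mem_vanishIdeal hΨ0
    (derivation_mem_of_fixesOrigin hX (hΦ0.mem_vanishIdeal i)))
  have hΨ_Φ : ∀ f : FSeries m ℂ, MvPowerSeries.subst Φ (MvPowerSeries.subst Ψ f) = f :=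
    fun f => by rw [← subst_formalComp hΨ0 hΦ0, hΨΦ, subst_formalId]
  have hΦ_Ψ : ∀ f : FSeries m ℂ, MvPowerSeries.subst Ψ (MvPowerSeries.subst Φ f) = f :=
    fun f => by rw [← subst_formalComp hΦ0 hΨ0, hΦΨ, subst_formalId]
  have hpush : FormalPushforwardEq Φ X Y := fun i => by
    rw [hΨ_Φ, VField.derivation_apply]
    exact Finset.sum_congr rfl fun j _ => mul_comm _ _
  have hshift : ∀ (c : ℂ) (p : ℕ) (f : FSeries m ℂ),
      MvPowerSeries.subst Φ ((Y.shift c ^ p) f) =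
        (X.shift c ^ p) (MvPowerSeries.subst Φ f) := by
    intro c p
    induction p with
    | zero => exact fun f => rfl
    | succ p ih =>
      intro f
      rw [pow_succ, Module.End.mul_apply, ih, pow_succ, Module.End.mul_apply, VField.shift_apply,
        VField.shift_apply, MvPowerSeries.subst_sub hΦ0.hasSubst,
        MvPowerSeries.subst_smul hΦ0.hasSubst, VField.derivation_subst hΦ0 hpush]
  have hcoord : ∀ j, Y.IsGenEigen (γ j) (MvPowerSeries.X j) := by
    intro j q
    obtain ⟨p, hp⟩ := hΦγ j q
    refine ⟨p, ?_⟩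
    rw [← hΦ_Ψ ((Y.shift (γ j) ^ p) (MvPowerSeries.X j)), hshift,
      MvPowerSeries.subst_X hΦ0.hasSubst]
    exact subst_mem_vanishIdeal hΨ0 hp
  -- `Y i` is `Y` applied to the `i`-th coordinate, hence has the same generalized eigenvalue;
  -- `coeff_eq_zero_of_isGenEigen` then leaves only resonant monomials.
  have hYeig : ∀ i, Y.IsGenEigen (γ i) (Y i) := by
    intro i
    rw [← Y.derivation_X i]
    exact (hcoord i).derivation hY0
  have hres : ∀ i n, ∑ j, γ j * (n j : ℂ) ≠ γ i → MvPowerSeries.coeff n (Y i) = 0 :=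
    fun i n => coeff_eq_zero_of_isGenEigen hY0 hcoord (hYeig i)
  have hres1 : ∀ i j, γ j ≠ γ i → linearPart Y i j = 0 := by
    intro i j hij
    refine hres i _ ?_
    simpa [Finsupp.single_apply] using hij
  have hcomm : Commute (Matrix.diagonal γ) (linearPart Y - Matrix.diagonal γ) := by
    refine Commute.sub_right ?_ (Commute.refl _)
    ext1 i j
    rw [Matrix.diagonal_mul, Matrix.mul_diagonal]
    by_cases hij : γ j = γ i
    · rw [hij, mul_comm]
    · rw [hres1 i j hij, mul_zero, zero_mul]
  refine ⟨Φ, Y, γ, hΦ, hpush, hY0, ⟨?_, hcomm⟩, ?_⟩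
  -- The linear terms of `(Y - γ i)^p x_i` form the `i`-th row of the `p`-th power of `linearPart Y
  -- - diag γ`; since this series vanishes to order two for some `p`, each row dies.
  · have hrow : ∀ i, ∃ p, Matrix.vecMul (Pi.single i 1)
        ((linearPart Y - Matrix.diagonal γ) ^ p) = 0 := by
      intro i
      obtain ⟨p, hp⟩ := hcoord i 2
      refine ⟨p, eq_zero_of_linearForm_mem ?_⟩
      rw [← single_vecMul_sub_smul_pow hcomm, sub_add_cancel]
      have := sub_mem hp (linearForm_single (K := ℂ) i ▸
        shift_pow_linearForm_sub_mem hY0 (γ i) (Pi.single i 1) p)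
      rwa [sub_sub_cancel] at this
    choose p hp using hrow
    refine ⟨Finset.univ.sup p, ?_⟩
    ext1 i j
    obtain ⟨r, hr⟩ := Nat.exists_eq_add_of_le (Finset.le_sup (f := p) (Finset.mem_univ i))
    have h1 : Matrix.vecMul (Pi.single i 1)
        ((linearPart Y - Matrix.diagonal γ) ^ Finset.univ.sup p) = 0 := by
      rw [hr, pow_add, ← Matrix.vecMul_vecMul, hp, Matrix.zero_vecMul]
    have := congrFun h1 j
    rwa [Matrix.single_one_vecMul] at this
  · funext i
    simp only [lieBracketCoord, Finset.sum_sub_distrib, ← VField.derivation_apply, Pi.zero_apply]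
    have h1 : Y.derivation (diagField γ i) = γ i • Y i := by
      rw [diagField, ← MvPowerSeries.smul_eq_C_mul, Derivation.map_smul, VField.derivation_X]
    rw [h1, sub_eq_zero]
    ext n
    rw [MvPowerSeries.coeff_smul, coeff_derivation_diagField]
    by_cases hn : ∑ j, γ j * (n j : ℂ) = γ i
    · rw [hn]
    · rw [hres i n hn, mul_zero, mul_zero]

theorem torusWeight_mul {d : ℕ} (ρ : Fin d → Fin m → ℤ) (s t : Fin d → Circle) (j : Fin m) :
    torusWeight ρ (s * t) j = torusWeight ρ s j * torusWeight ρ t j := by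
  simp [torusWeight, mul_zpow, Finset.prod_mul_distrib]

theorem formalComp_diagField_diagField (v w : Fin m → K) :
    formalComp (diagField v) (diagField w) = diagField fun j => v j * w j := by
  rw [formalComp_diagField (fixesOrigin_diagField w)]
  funext j
  simp [diagField, mul_assoc]

/-- Every formal vector field vanishing at the origin has an associated torus action. -/
theorem exists_isAssociatedTorusAction {X : VField m (FSeries m ℂ)} (hX : FixesOrigin X) :
    ∃ (d : ℕ) (A : FormalTorusAction d m), IsAssociatedTorusAction X A := by
  obtain ⟨Φ, Y, γ, hΦ, hXY, hY⟩ := exists_poincareDulac hX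
  obtain ⟨α, ρ, hdec, heff⟩ := exists_effective_decomposition γ
  obtain ⟨hΦ0, Ψ, hΨ0, hΦΨ, hΨΦ⟩ := id hΦ
  let τ : (Fin (toricDegree γ) → Circle) → Fin m → FSeries m ℂ :=
    fun t => diagField fun j => (torusWeight ρ t j : ℂ)
  have hτ0 : ∀ t, FixesOrigin (τ t) := fun t => fixesOrigin_diagField _
  have hτΦ : ∀ t, FixesOrigin (formalComp (τ t) Φ) := fun t => (hτ0 t).formalComp hΦ0
  have hτ1 : τ 1 = formalId m ℂ := by
    funext j
    simp [τ, diagField, torusWeight, formalId]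
  have hτm : ∀ s t, τ (s * t) = formalComp (τ s) (τ t) := by
    intro s t
    simp only [τ, formalComp_diagField_diagField, torusWeight_mul, Circle.coe_mul]
  have hcancel : ∀ f : Fin m → FSeries m ℂ, FixesOrigin f → formalComp Φ (formalComp Ψ f) = f :=
    fun f hf => by rw [← formalComp_assoc Φ hΨ0 hf, hΦΨ, formalId_formalComp hf]
  refine ⟨toricDegree γ,
    { act := fun t => formalComp Ψ (formalComp (τ t) Φ)
      fixesOrigin := fun t => hΨ0.formalComp (hτΦ t)
      act_one := by rw [hτ1, formalId_formalComp hΦ0, hΨΦ]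
      act_mul := fun s t => ?_ }, Φ, Y, γ, α, ρ, hΦ, hXY, hY, hdec, rfl, heff, fun t j => ?_⟩
  · rw [formalComp_assoc Ψ (hτΦ s) (hΨ0.formalComp (hτΦ t)),
      formalComp_assoc (τ s) hΦ0 (hΨ0.formalComp (hτΦ t)), hcancel _ (hτΦ t), hτm,
      formalComp_assoc (τ s) (hτ0 t) hΦ0]
  · rw [hcancel _ (hτΦ t), formalComp_diagField hΦ0]

end NormalForm

/-! ### Naturality of the Lie derivative under homomorphisms of the coefficients -/

/-- Serves for complexification, for Taylor expansion, and for the inclusion of functions analytic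
at the origin into all functions. -/
theorem lieDerivCoord_map {m k h : ℕ} {R S : Type*} [CommRing R] [CommRing S] (g : R →+* S)
    {D : Fin m → R → R} {D' : Fin m → S → S} (hD : ∀ i r, g (D i r) = D' i (g r))
    (X : VField m R) (G : TField m k h R) (a : Fin k → Fin m) (b : Fin h → Fin m) :
    lieDerivCoord D' (fun i => g (X i)) (fun a b => g (G a b)) a b =
      g (lieDerivCoord D X G a b) := by
  simp only [lieDerivCoord, map_add, map_sub, map_sum, map_mul, hD]

section Complexification

variable {m k h : ℕ} {K : Type*} [RCLike K]

theorem map_formalPartial {R S : Type*} [CommRing R] [CommRing S] (g : R →+* S) (i : Fin m)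
    (f : FSeries m R) :
    MvPowerSeries.map g (formalPartial i f) = formalPartial i (MvPowerSeries.map g f) := by
  ext n
  simp only [formalPartial, MvPowerSeries.coeff_map, MvPowerSeries.coeff_pderiv, map_mul, map_add,
    map_natCast, map_one]

theorem fixesOrigin_complexify {X : VField m (FSeries m K)} (hX : FixesOrigin X) :
    FixesOrigin X.complexify := fun i => by
  rw [VField.complexify, MvPowerSeries.constantCoeff_map, hX i, map_zero]

theorem lieDerivCoord_complexify {X : VField m (FSeries m K)} {G : TField m k h (FSeries m K)}
    (hG : lieDerivCoord formalPartial X G = 0) :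
    lieDerivCoord formalPartial X.complexify G.complexify = 0 := by
  funext a b
  have := lieDerivCoord_map (MvPowerSeries.map (σ := Fin m) (toComplexHom K))
    (map_formalPartial (toComplexHom K)) X G a b
  rw [hG, Pi.zero_apply, Pi.zero_apply, map_zero] at this
  exact this

end Complexification

/-! ### Taylor series of analytic functions -/

section Taylor

variable {m : ℕ} {K : Type*} [RCLike K]

protected theorem AnalyticAt.partialDeriv {f : (Fin m → K) → K} {x : Fin m → K}
    (hf : AnalyticAt K f x)
    (i : Fin m) : AnalyticAt K (partialDeriv i f) x :=
  ((ContinuousLinearMap.apply K K (Pi.single i (1 : K) : Fin m → K)).analyticAt _).comp hf.fderiv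

protected theorem Filter.EventuallyEq.partialDeriv {f g : (Fin m → K) → K} {x : Fin m → K}
    (h : f =ᶠ[𝓝 x] g) (i : Fin m) : partialDeriv i f =ᶠ[𝓝 x] partialDeriv i g := by
  filter_upwards [h.fderiv (𝕜 := K)] with y hy
  simp only [partialDeriv, hy]

/-- Symmetry of the second derivative, stated near `x` rather than at `x` because only equality of
germs survives further differentiation. -/
theorem partialDeriv_comm {f : (Fin m → K) → K} {x : Fin m → K} (hf : AnalyticAt K f x)
    (i j : Fin m) :
    partialDeriv i (partialDeriv j f) =ᶠ[𝓝 x] partialDeriv j (partialDeriv i f) := by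
  filter_upwards [hf.eventually_analyticAt] with y hy
  have h1 : ∀ i j : Fin m, partialDeriv i (partialDeriv j f) y =
      fderiv K (fderiv K f) y (Pi.single i 1) (Pi.single j 1) := by
    intro i j
    have hd : DifferentiableAt K (fderiv K f) y := hy.fderiv.differentiableAt
    have : HasFDerivAt (partialDeriv j f)
        ((ContinuousLinearMap.apply K K (Pi.single j (1 : K) : Fin m → K)).comp
          (fderiv K (fderiv K f) y)) y :=
      (ContinuousLinearMap.apply K K (Pi.single j (1 : K) : Fin m → K)).hasFDerivAt.comp y
        hd.hasFDerivAt
    rw [partialDeriv, this.fderiv]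
    rfl
  rw [h1, h1]
  exact (hy.contDiffAt.isSymmSndFDerivAt_of_omega).eq _ _

theorem AnalyticAt.partialDeriv_iterate {f : (Fin m → K) → K} {x : Fin m → K}
    (hf : AnalyticAt K f x) (i : Fin m) (p : ℕ) : AnalyticAt K ((partialDeriv i)^[p] f) x := by
  induction p with
  | zero => exact hf
  | succ p ih => rw [Function.iterate_succ_apply']; exact ih.partialDeriv i

theorem Filter.EventuallyEq.partialDeriv_iterate {f g : (Fin m → K) → K} {x : Fin m → K}
    (h : f =ᶠ[𝓝 x] g) (i : Fin m) (p : ℕ) :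
    (partialDeriv i)^[p] f =ᶠ[𝓝 x] (partialDeriv i)^[p] g := by
  induction p with
  | zero => exact h
  | succ p ih => rw [Function.iterate_succ_apply', Function.iterate_succ_apply']
                 exact ih.partialDeriv i

theorem partialDeriv_iterate_comm {f : (Fin m → K) → K} {x : Fin m → K} (hf : AnalyticAt K f x)
    (i j : Fin m) (p : ℕ) :
    partialDeriv i ((partialDeriv j)^[p] f) =ᶠ[𝓝 x] (partialDeriv j)^[p] (partialDeriv i f) := by
  induction p with
  | zero => exact Filter.EventuallyEq.rfl
  | succ p ih =>
    rw [Function.iterate_succ_apply', Function.iterate_succ_apply']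
    exact (partialDeriv_comm (hf.partialDeriv_iterate j p) i j).trans (ih.partialDeriv j)

/-- The mixed partial derivatives of orders `n i`, `i ∈ l`. -/
noncomputable def mixedPartial (l : List (Fin m)) (n : Fin m → ℕ) (f : (Fin m → K) → K) :
    (Fin m → K) → K :=
  l.foldr (fun i g => (partialDeriv i)^[n i] g) f

theorem mixedPartial_cons (i : Fin m) (l : List (Fin m)) (n : Fin m → ℕ) (f : (Fin m → K) → K) :
    mixedPartial (i :: l) n f = (partialDeriv i)^[n i] (mixedPartial l n f) := rfl

protected theorem AnalyticAt.mixedPartial {f : (Fin m → K) → K} {x : Fin m → K}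
    (hf : AnalyticAt K f x)
    (l : List (Fin m)) (n : Fin m → ℕ) : AnalyticAt K (mixedPartial l n f) x := by
  induction l with
  | nil => exact hf
  | cons i l ih => rw [mixedPartial_cons]; exact ih.partialDeriv_iterate i _

protected theorem Filter.EventuallyEq.mixedPartial {f g : (Fin m → K) → K} {x : Fin m → K}
    (h : f =ᶠ[𝓝 x] g) (l : List (Fin m)) (n : Fin m → ℕ) :
    mixedPartial l n f =ᶠ[𝓝 x] mixedPartial l n g := by
  induction l with
  | nil => exact h
  | cons i l ih => rw [mixedPartial_cons, mixedPartial_cons]; exact ih.partialDeriv_iterate i _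

theorem partialDeriv_mixedPartial {f : (Fin m → K) → K} {x : Fin m → K} (hf : AnalyticAt K f x)
    (i : Fin m) (l : List (Fin m)) (n : Fin m → ℕ) :
    partialDeriv i (mixedPartial l n f) =ᶠ[𝓝 x] mixedPartial l n (partialDeriv i f) := by
  induction l with
  | nil => exact Filter.EventuallyEq.rfl
  | cons j l ih =>
    rw [mixedPartial_cons, mixedPartial_cons]
    exact (partialDeriv_iterate_comm (hf.mixedPartial l n) i j _).trans
      (ih.partialDeriv_iterate j _)

/-- The two cases support each other in the induction on the list: as the list has no repetition,
the tail after the occurrence of `i` does not see the increment, and the extra derivative is moved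
innermost by commutation. -/
theorem mixedPartial_add_single {f : (Fin m → K) → K} {x : Fin m → K} (hf : AnalyticAt K f x)
    (i : Fin m) {l : List (Fin m)} (hl : l.Nodup) (n : Fin m →₀ ℕ) :
    (i ∉ l → mixedPartial l (n + Finsupp.single i 1 : Fin m →₀ ℕ) f = mixedPartial l n f) ∧
    (i ∈ l → mixedPartial l (n + Finsupp.single i 1 : Fin m →₀ ℕ) f =ᶠ[𝓝 x]
      mixedPartial l n (partialDeriv i f)) := by
  induction l with
  | nil => exact ⟨fun _ => rfl, fun h => absurd h (List.not_mem_nil)⟩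
  | cons j l ih =>
    obtain ⟨hj, hl⟩ := List.nodup_cons.1 hl
    obtain ⟨ih1, ih2⟩ := ih hl
    simp only [mixedPartial_cons]
    by_cases hij : i = j
    · subst hij
      refine ⟨fun h => absurd (List.mem_cons_self) h, fun _ => ?_⟩
      rw [ih1 hj, Finsupp.add_apply, Finsupp.single_eq_same, Function.iterate_succ_apply]
      exact (partialDeriv_mixedPartial hf i l n).partialDeriv_iterate i _
    · have hn : (n + Finsupp.single i 1 : Fin m →₀ ℕ) j = n j := by
        rw [Finsupp.add_apply, Finsupp.single_eq_of_ne (Ne.symm hij), add_zero]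
      rw [hn]
      refine ⟨fun h => ?_, fun h => ?_⟩
      · rw [ih1 fun h' => h (List.mem_cons_of_mem _ h')]
      · exact (ih2 ((List.mem_cons.1 h).resolve_left hij)).partialDeriv_iterate j _

theorem coeff_taylorSeries (f : (Fin m → K) → K) (n : Fin m →₀ ℕ) :
    MvPowerSeries.coeff n (taylorSeries f) =
      mixedPartial (List.finRange m) n f 0 / ∏ i, (Nat.factorial (n i) : K) := rfl

theorem taylorSeries_congr {f g : (Fin m → K) → K} (h : f =ᶠ[𝓝 0] g) :
    taylorSeries f = taylorSeries g := by
  ext n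
  rw [coeff_taylorSeries, coeff_taylorSeries,
    (h.mixedPartial (List.finRange m) n).eq_of_nhds]

theorem constantCoeff_taylorSeries (f : (Fin m → K) → K) :
    MvPowerSeries.constantCoeff (taylorSeries f) = f 0 := by
  rw [← MvPowerSeries.coeff_zero_eq_constantCoeff_apply, coeff_taylorSeries]
  have : ∀ l : List (Fin m), mixedPartial l (0 : Fin m →₀ ℕ) f = f := by
    intro l
    induction l with
    | nil => rfl
    | cons i l ih => rw [mixedPartial_cons, ih]; rfl
  rw [this]
  simp

theorem taylorSeries_partialDeriv {f : (Fin m → K) → K} (hf : AnalyticAt K f 0) (i : Fin m) :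
    taylorSeries (partialDeriv i f) = formalPartial i (taylorSeries f) := by
  ext n
  rw [formalPartial, MvPowerSeries.coeff_pderiv, coeff_taylorSeries, coeff_taylorSeries,
    ((mixedPartial_add_single hf i (List.nodup_finRange m) n).2 (List.mem_finRange i)).eq_of_nhds]
  have h1 : ∏ j, (Nat.factorial ((n + Finsupp.single i 1 : Fin m →₀ ℕ) j) : K) =
      (n i + 1) * ∏ j, (Nat.factorial (n j) : K) := by
    rw [← Finset.mul_prod_erase _ _ (Finset.mem_univ i),
      ← Finset.mul_prod_erase _ (fun j => (Nat.factorial (n j) : K)) (Finset.mem_univ i),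
      ← mul_assoc]
    congr 1
    · rw [Finsupp.add_apply, Finsupp.single_eq_same, Nat.factorial_succ]
      push_cast
      ring
    · refine Finset.prod_congr rfl fun j hj => ?_
      rw [Finsupp.add_apply, Finsupp.single_eq_of_ne (Finset.ne_of_mem_erase hj), add_zero]
  have h2 : ∏ j, (Nat.factorial (n j) : K) ≠ 0 :=
    Finset.prod_ne_zero_iff.2 fun j _ => by exact_mod_cast Nat.factorial_ne_zero _
  have h3 : (n i + 1 : K) ≠ 0 := Nat.cast_add_one_ne_zero _
  rw [h1]
  field_simp

/-- Induction on the order: a coefficient of positive degree is, up to a nonzero integer factor, a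
coefficient of lower degree of a partial derivative. A whole family is needed because the derivative
of one member is expressed through other members. -/
theorem eq_of_constantCoeff_eq_of_pderiv {T : Type*} (F G : T → FSeries m K)
    (h0 : ∀ t, MvPowerSeries.constantCoeff (F t) = MvPowerSeries.constantCoeff (G t))
    (h : ∀ (q : ℕ), (∀ t, F t - G t ∈ vanishIdeal m K q) → ∀ t i,
      formalPartial i (F t) - formalPartial i (G t) ∈ vanishIdeal m K q) (t : T) : F t = G t := by
  suffices H : ∀ q t, F t - G t ∈ vanishIdeal m K q from
    sub_eq_zero.1 (eq_zero_of_forall_mem_vanishIdeal fun q => H q t)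
  intro q
  induction q with
  | zero => exact fun t => mem_vanishIdeal_zero _
  | succ q ih =>
    intro t n hn
    by_cases hn0 : n = 0
    · subst hn0
      rw [MvPowerSeries.coeff_zero_eq_constantCoeff_apply, map_sub, h0, sub_self]
    · obtain ⟨i, hi⟩ := Finsupp.ne_iff.1 hn0
      have hle : Finsupp.single i 1 ≤ n :=
        Finsupp.single_le_iff.2 (Nat.one_le_iff_ne_zero.2 hi)
      obtain ⟨n', rfl⟩ := exists_add_of_le hle
      rw [map_add, Finsupp.degree_single] at hn
      have h1 := h q ih t i n' (by omega)
      rw [formalPartial, formalPartial, ← map_sub, MvPowerSeries.coeff_pderiv, add_comm n'] at h1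
      exact (mul_eq_zero.1 h1).resolve_right (Nat.cast_add_one_ne_zero _)

theorem partialDeriv_add_eventuallyEq {f g : (Fin m → K) → K} {x : Fin m → K}
    (hf : AnalyticAt K f x) (hg : AnalyticAt K g x) (i : Fin m) :
    partialDeriv i (f + g) =ᶠ[𝓝 x] partialDeriv i f + partialDeriv i g := by
  filter_upwards [hf.eventually_analyticAt, hg.eventually_analyticAt] with y hfy hgy
  simp [partialDeriv, fderiv_add hfy.differentiableAt hgy.differentiableAt]

theorem partialDeriv_mul_eventuallyEq {f g : (Fin m → K) → K} {x : Fin m → K}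
    (hf : AnalyticAt K f x) (hg : AnalyticAt K g x) (i : Fin m) :
    partialDeriv i (f * g) =ᶠ[𝓝 x] f * partialDeriv i g + g * partialDeriv i f := by
  filter_upwards [hf.eventually_analyticAt, hg.eventually_analyticAt] with y hfy hgy
  simp [partialDeriv, fderiv_mul hfy.differentiableAt hgy.differentiableAt]

theorem taylorSeries_add {f g : (Fin m → K) → K} (hf : AnalyticAt K f 0)
    (hg : AnalyticAt K g 0) : taylorSeries (f + g) = taylorSeries f + taylorSeries g := by
  refine eq_of_constantCoeff_eq_of_pderiv
    (T := {p : ((Fin m → K) → K) × ((Fin m → K) → K) // AnalyticAt K p.1 0 ∧ AnalyticAt K p.2 0})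
    (fun p => taylorSeries (p.1.1 + p.1.2))
    (fun p => taylorSeries p.1.1 + taylorSeries p.1.2) ?_ ?_ ⟨(f, g), hf, hg⟩
  · intro p
    simp [constantCoeff_taylorSeries]
  · rintro q h ⟨⟨f, g⟩, hf, hg⟩ i
    have h1 := h ⟨(partialDeriv i f, partialDeriv i g), hf.partialDeriv i, hg.partialDeriv i⟩
    simp only at h1 hf hg ⊢
    rw [← taylorSeries_partialDeriv (hf.add hg),
      taylorSeries_congr (partialDeriv_add_eventuallyEq hf hg i)]
    rw [taylorSeries_partialDeriv hf, taylorSeries_partialDeriv hg] at h1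
    rwa [formalPartial, map_add]

theorem taylorSeries_mul {f g : (Fin m → K) → K} (hf : AnalyticAt K f 0)
    (hg : AnalyticAt K g 0) : taylorSeries (f * g) = taylorSeries f * taylorSeries g := by
  refine eq_of_constantCoeff_eq_of_pderiv
    (T := {p : ((Fin m → K) → K) × ((Fin m → K) → K) // AnalyticAt K p.1 0 ∧ AnalyticAt K p.2 0})
    (fun p => taylorSeries (p.1.1 * p.1.2))
    (fun p => taylorSeries p.1.1 * taylorSeries p.1.2) ?_ ?_ ⟨(f, g), hf, hg⟩
  · intro p
    simp [constantCoeff_taylorSeries]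
  · rintro q h ⟨⟨f, g⟩, hf, hg⟩ i
    -- The Leibniz rule expresses the derivative of a product through the pairs `(f, ∂g)` and `(g,
    -- ∂f)`, both in the family.
    have h1 := h ⟨(f, partialDeriv i g), hf, hg.partialDeriv i⟩
    have h2 := h ⟨(g, partialDeriv i f), hg, hf.partialDeriv i⟩
    simp only at h1 h2 hf hg ⊢
    rw [← taylorSeries_partialDeriv (hf.mul hg),
      taylorSeries_congr (partialDeriv_mul_eventuallyEq hf hg i),
      taylorSeries_add (hf.mul (hg.partialDeriv i)) (hg.mul (hf.partialDeriv i))]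
    rw [taylorSeries_partialDeriv hg] at h1
    rw [taylorSeries_partialDeriv hf] at h2
    rw [formalPartial, Derivation.leibniz, smul_eq_mul, smul_eq_mul, add_sub_add_comm]
    exact add_mem h1 h2

theorem partialDeriv_const (c : K) (i : Fin m) :
    partialDeriv i (fun _ : Fin m → K => c) = 0 := by
  funext x
  simp [partialDeriv]

theorem taylorSeries_const (c : K) :
    taylorSeries (fun _ : Fin m → K => c) = MvPowerSeries.C c := by
  refine MvPowerSeries.pderiv.ext (fun i => ?_) ?_
  · rw [MvPowerSeries.pderiv_C]
    have := taylorSeries_partialDeriv (analyticAt_const (𝕜 := K) (v := c) (x := (0 : Fin m → K))) i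
    rw [formalPartial] at this
    rw [← this, partialDeriv_const]
    ext n
    have hz : ∀ (l : List (Fin m)) (n : Fin m → ℕ), mixedPartial l n (0 : (Fin m → K) → K) = 0 := by
      intro l n
      induction l with
      | nil => rfl
      | cons i l ih =>
        rw [mixedPartial_cons, ih]
        exact Function.iterate_fixed (partialDeriv_const (0 : K) i) _
    rw [coeff_taylorSeries, hz]
    simp
  · simp [constantCoeff_taylorSeries]

/-- The ring of functions analytic at the origin. -/
def analyticSubring (m : ℕ) (K : Type*) [RCLike K] : Subring ((Fin m → K) → K) where
  carrier := {f | AnalyticAt K f 0}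
  mul_mem' := fun hf hg => hf.mul hg
  one_mem' := analyticAt_const
  add_mem' := fun hf hg => hf.add hg
  zero_mem' := analyticAt_const
  neg_mem' := fun hf => hf.neg

/-- The Taylor series as a ring homomorphism. -/
noncomputable def taylorHom (m : ℕ) (K : Type*) [RCLike K] :
    analyticSubring m K →+* FSeries m K where
  toFun f := taylorSeries f.1
  map_one' := taylorSeries_const 1
  map_mul' f g := taylorSeries_mul f.2 g.2
  map_zero' := (taylorSeries_const 0).trans (map_zero _)
  map_add' f g := taylorSeries_add f.2 g.2

/-- The Lie derivative is formed in the ring of functions analytic at the origin and mapped both to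
functions and to formal series. Since Taylor series depend only on the germ, vanishing near the
origin is enough. -/
theorem lieDerivCoord_taylor {k h : ℕ} {X : VField m ((Fin m → K) → K)}
    (hX : ∀ i, AnalyticAt K (X i) 0) {G : TField m k h ((Fin m → K) → K)}
    (hG : ∀ a b, AnalyticAt K (G a b) 0)
    (h0 : ∀ a b, lieDerivCoord partialDeriv X G a b =ᶠ[𝓝 0] 0) :
    lieDerivCoord formalPartial X.taylor G.taylor = 0 := by
  funext a b
  let D : Fin m → analyticSubring m K → analyticSubring m K :=
    fun i f => ⟨partialDeriv i f.1, AnalyticAt.partialDeriv f.2 i⟩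
  let X' : VField m (analyticSubring m K) := fun i => ⟨X i, hX i⟩
  let G' : TField m k h (analyticSubring m K) := fun a b => ⟨G a b, hG a b⟩
  have h1 := lieDerivCoord_map (taylorHom m K) (D := D) (D' := formalPartial)
    (fun i f => taylorSeries_partialDeriv f.2 i) X' G' a b
  have h2 := lieDerivCoord_map (analyticSubring m K).subtype (D := D) (D' := partialDeriv)
    (fun i f => rfl) X' G' a b
  refine h1.trans ?_
  change taylorSeries ((analyticSubring m K).subtype (lieDerivCoord D X' G' a b)) = 0
  rw [← h2]
  exact (taylorSeries_congr (h0 a b)).trans ((taylorSeries_const 0).trans (map_zero _))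

end Taylor

theorem mainTheorem3 {K : Type*} [RCLike K] (m : ℕ) :
    -- formal vector fields: the associated torus action exists and preserves formal tensor fields
    (∀ X : VField m (FSeries m K), FixesOrigin X →
      (∃ (d : ℕ) (A : FormalTorusAction d m), IsAssociatedTorusAction X.complexify A) ∧
      ∀ (k h : ℕ) (G : TField m k h (FSeries m K)), lieDerivCoord formalPartial X G = 0 →
        ∀ (d : ℕ) (A : FormalTorusAction d m), IsAssociatedTorusAction X.complexify A →
          A.Preserves G.complexify) ∧
    -- analytic vector fields and analytic tensor fields near the origin
    (∀ X : VField m ((Fin m → K) → K), (∀ i, AnalyticAt K (X i) 0) → (∀ i, X i 0 = 0) →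
      (∃ (d : ℕ) (A : FormalTorusAction d m), IsAssociatedTorusAction X.taylor.complexify A) ∧
      ∀ (k h : ℕ) (G : TField m k h ((Fin m → K) → K)), (∀ a b, AnalyticAt K (G a b) 0) →
        (∀ a b, lieDerivCoord partialDeriv X G a b =ᶠ[𝓝 0] 0) →
        ∀ (d : ℕ) (A : FormalTorusAction d m), IsAssociatedTorusAction X.taylor.complexify A →
          A.Preserves G.taylor.complexify) := by
  refine ⟨fun X hX => ⟨exists_isAssociatedTorusAction (fixesOrigin_complexify hX),
    fun k h G hG d A hA => hA.preserves (lieDerivCoord_complexify hG)⟩, fun X hX hX0 => ?_⟩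
  have hT : FixesOrigin X.taylor := fun i => (constantCoeff_taylorSeries (X i)).trans (hX0 i)
  exact ⟨exists_isAssociatedTorusAction (fixesOrigin_complexify hT),
    fun k h G hG hXG d A hA =>
      hA.preserves (lieDerivCoord_complexify (lieDerivCoord_taylor hX hG hXG))⟩
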